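/- Let $f:\mathbb R^n\to\mathbb R$, $g:\mathbb R^n\to\mathbb R^m$ and $G:\mathbb R^n\to\mathbb S^d$ be twice continuously differentiable, where $\mathbb S^d$ is the space of real symmetric $d\times d$ matrices with $\langle V,W\rangle=\mathrm{tr}(V^\top W)$ and Frobenius norm $\|\cdot\|_F$. Consider the problem of minimizing $f(x)$ subject to $g(x)=0$, $G(x)\succeq O$. For $X\in\mathbb S^d$, $[X]_+$ is obtained by replacing each eigenvalue $t$ of $X$ by $\max\{t,0\}$, $X^\dagger$ is the Moore–Penrose inverse, and $V\circledcirc W=\frac12(VW+WV)$. Put $$\mathcal F(x;\gamma)=f(x)+\tfrac{\gamma}{2}\|g(x)\|^2+\tfrac{\gamma}{4}\mathrm{tr}([-G(x)]_+^4),\qquad \mathcal P(x)=\tfrac12\|g(x)\|^2+\tfrac14\mathrm{tr}([-G(x)]_+^4),$$ $$L(x,y,Z)=f(x)-\langle g(x),y\rangle-\langle G(x),Z\rangle,\qquad \sigma(x,Z)=\big[\,2\langle Z,G_i(x)G(x)^\dagger G_j(x)\rangle\,\big]_{i,j=1}^n,\quad G_i=\partial G/\partial x_i .$$ **Sequential optimality.**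 Let $\bar x$ be feasible. For $x$ near $\bar x$ let $S(x,\bar x)$ be the set of $h\in\mathbb R^n$ with $\nabla g(x)^\top h=0$ and $U^\top(\mathrm DG(x)h)U=O$, where the columns of $U$ form an orthonormal basis of the space spanned by the eigenvectors for the $\dim\ker G(\bar x)$ smallest eigenvalues of $G(x)$. A sequence $(x_k,y_k,Z_k,\varepsilon_k)\in\mathbb R^n\times\mathbb R^m\times\mathbb S^d_+\times(0,\infty)$ is an *AKKT2 sequence* corresponding to $\bar x$ if $x_k\to\bar x$, $\varepsilon_k\to0$, $\nabla_xL(x_k,y_k,Z_k)\to0$, and (a) there are orthogonal matrices $P_k\to P$ with $G(\bar x)=P\,\mathrm{diag}(\mu_1,\dots,\mu_d)P^\top$ and $Z_k=P_k\,\mathrm{diag}(\zeta_1^k,\dots,\zeta_d^k)P_k^\top$ such that, for each $j$ with $\mu_j>0$, $\zeta_j^k=0$ for all sufficiently large $k$; (b) for all sufficiently large $k$ and all $h\in S(x_k,\bar x)$, $h^\top(\nabla^2_{xx}L(x_k,y_k,Z_k)+\sigma(x_k,Z_k))h\ge-\varepsilon_k\|h\|^2$. It is a *CAKKT2 sequence*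 if (a) is replaced by $G(x_k)\circledcirc Z_k\to O$. A feasible point $\bar x$ is an AKKT2 (CAKKT2) point if it has an AKKT2 (CAKKT2) sequence. **Algorithm.** Let $\eta\in(0,1)$, $\theta>1$, $\delta_k\in(0,1)$ with $\delta_k\to0$, $x_0$ feasible, $\widehat x_0=x_0$, $\gamma_0>0$, and $u_k=\max\{\|g(x_k)\|,\|[-G(x_k)]_+\|_F\}$. For $k=0,1,2,\dots$ a descent method (such as a trust region method) for $\mathcal F(\cdot\,;\gamma_k)$ started at $\widehat x_k$ returns $x_{k+1}$ with $\mathcal F(x_{k+1};\gamma_k)\le\mathcal F(\widehat x_k;\gamma_k)$ and $$\|\nabla\mathcal F(x_{k+1};\gamma_k)\|\le\delta_k,\qquad \nabla^2\mathcal F(x_{k+1};\gamma_k)+\delta_kI\succeq O.$$ Then $\widehat x_{k+1}=x_{k+1}$ if $\mathcal F(x_{k+1};\gamma_k)\le f(x_0)$, and $\widehat x_{k+1}=x_0$ otherwise; $\gamma_{k+1}=\gamma_k$ if $k=0$ or $u_{k+1}\le\eta u_k$, and $\gamma_{k+1}=\theta\gamma_k$ otherwise. **Theorem (global convergence).** Let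 $\{x_k\}$ be generated by the algorithm, and let $y_k=-\gamma_{k-1}g(x_k)$, $Z_k=\gamma_{k-1}[-G(x_k)]_+^3$, $\varepsilon_k=\delta_{k-1}$ for $k\ge1$. Assume that $\{f(x_k)\}$ is bounded below (this holds, for instance, if $\{x_k\}$ is bounded or convergent). Let $\bar x$ be an accumulation point of $\{x_k\}$. Then: (i) $\bar x$ is an AKKT2 point, and every subsequence (with indices $k\ge1$) along which $x_k\to\bar x$ has a further subsequence along which $(x_k,y_k,Z_k,\varepsilon_k)$ is an AKKT2 sequence corresponding to $\bar x$. (ii) If $\bar x$ satisfies the generalized Polyak–Łojasiewicz inequality, that is, if there are $\nu>0$ and a function $\Psi$ with $\Psi(x)\to0$ as $x\to\bar x$ such that $|\mathcal P(x)-\mathcal P(\bar x)|\le\Psi(x)\|\nabla\mathcal P(x)\|$ whenever $\|x-\bar x\|\le\nu$, then $\bar x$ is a CAKKT2 point, and along every subsequence (with indices $k\ge1$) with $x_k\to\bar x$, $(x_k,y_k,Z_k,\varepsilon_k)$ is a CAKKT2 sequence corresponding to $\bar x$. -/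

import Mathlib

open Filter Topology

/-- The nonlinear semidefinite program `min f x` subject to `g x = 0`, `G x ⪰ 0`, where
`f`, `g`, `G` are twice continuously differentiable and `G` takes symmetric values. (A matrix
valued function is `C²` if and only if its entries are.) -/
structure NSDP (n m d : ℕ) where
  f : EuclideanSpace ℝ (Fin n) → ℝ
  g : EuclideanSpace ℝ (Fin n) → EuclideanSpace ℝ (Fin m)
  G : EuclideanSpace ℝ (Fin n) → Matrix (Fin d) (Fin d) ℝ
  contDiff_f : ContDiff ℝ 2 f
  contDiff_g : ContDiff ℝ 2 g
  contDiff_G : ∀ i j, ContDiff ℝ 2 (fun x => G x i j)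
  isSymm_G : ∀ x, (G x).IsSymm

namespace NSDP

noncomputable section

/-! ### Matrices -/

/-- The trace inner product `⟨V, W⟩ = tr (Vᵀ W)`. -/
def matInner {d : ℕ} (V W : Matrix (Fin d) (Fin d) ℝ) : ℝ := (V.transpose * W).trace

/-- The Frobenius norm. -/
def frobNorm {d : ℕ} (W : Matrix (Fin d) (Fin d) ℝ) : ℝ := √(matInner W W)

/-- The symmetrized product `(VW + WV)/2`. -/
def symProd {d : ℕ} (V W : Matrix (Fin d) (Fin d) ℝ) : Matrix (Fin d) (Fin d) ℝ :=
  (1 / 2 : ℝ) • (V * W + W * V)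

/-- `[X]₊` for a symmetric matrix `X`: every eigenvalue `t` in an orthogonal diagonalization of
`X` is replaced by `max t 0`. -/
def matPos {d : ℕ} (X : Matrix (Fin d) (Fin d) ℝ) : Matrix (Fin d) (Fin d) ℝ :=
  cfc (fun t : ℝ => max t 0) X

/-- The Moore-Penrose inverse of a symmetric matrix `X`: every nonzero eigenvalue `t` in an
orthogonal diagonalization of `X` is replaced by `t⁻¹`, and zero eigenvalues are kept (in Lean,
`(0 : ℝ)⁻¹ = 0`). -/
def pinv {d : ℕ} (X : Matrix (Fin d) (Fin d) ℝ) : Matrix (Fin d) (Fin d) ℝ :=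
  cfc (fun t : ℝ => t⁻¹) X

/-- The four Penrose equations, which characterize the Moore-Penrose inverse. -/
theorem pinv_penrose {d : ℕ} {X : Matrix (Fin d) (Fin d) ℝ} (hX : X.IsSymm) :
    X * pinv X * X = X ∧ pinv X * X * pinv X = pinv X ∧
      (X * pinv X).IsSymm ∧ (pinv X * X).IsSymm := by
  have hs : IsSelfAdjoint X := by
    show star X = X
    rw [Matrix.star_eq_conjTranspose, Matrix.conjTranspose_eq_transpose_of_trivial]
    exact hX
  have hc : ∀ u : ℝ → ℝ, ContinuousOn u (spectrum ℝ X) := fun u =>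
    (Matrix.finite_real_spectrum (A := X)).continuousOn u
  have hsym : ∀ u : ℝ → ℝ, (cfc u X).IsSymm := by
    intro u
    have h : star (cfc u X) = cfc u X := (cfc_predicate u X : IsSelfAdjoint (cfc u X))
    rw [Matrix.star_eq_conjTranspose, Matrix.conjTranspose_eq_transpose_of_trivial] at h
    exact h
  have hid : X = cfc (fun t : ℝ => t) X := (cfc_id' ℝ X).symm
  have h1 : X * pinv X = cfc (fun t : ℝ => t * t⁻¹) X := by
    rw [cfc_mul (fun t : ℝ => t) (fun t : ℝ => t⁻¹) X (hc _) (hc _), ← hid]; rfl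
  have h2 : pinv X * X = cfc (fun t : ℝ => t⁻¹ * t) X := by
    rw [cfc_mul (fun t : ℝ => t⁻¹) (fun t : ℝ => t) X (hc _) (hc _), ← hid]; rfl
  refine ⟨?_, ?_, ?_, ?_⟩
  · have h3 : X * pinv X * X = cfc (fun t : ℝ => t * t⁻¹ * t) X := by
      rw [cfc_mul (fun t : ℝ => t * t⁻¹) (fun t : ℝ => t) X (hc _) (hc _), ← hid, h1]
    rw [h3]
    simp only [mul_inv_mul_cancel]
    exact hid.symm
  · have h3 : pinv X * X * pinv X = cfc (fun t : ℝ => t⁻¹ * t * t⁻¹) X := by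
      rw [cfc_mul (fun t : ℝ => t⁻¹ * t) (fun t : ℝ => t⁻¹) X (hc _) (hc _), h2]; rfl
    have h4 : (fun t : ℝ => t⁻¹ * t * t⁻¹) = fun t : ℝ => t⁻¹ := by
      funext t
      simpa using mul_inv_mul_cancel t⁻¹
    rw [h3, h4]
    rfl
  · rw [h1]; exact hsym _
  · rw [h2]; exact hsym _

/-! ### Derivatives -/

/-- The Hessian matrix of a real function. -/
def hessian {n : ℕ} (φ : EuclideanSpace ℝ (Fin n) → ℝ) (x : EuclideanSpace ℝ (Fin n)) :
    Matrix (Fin n) (Fin n) ℝ :=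
  Matrix.of fun i j =>
    fderiv ℝ (fderiv ℝ φ) x (EuclideanSpace.single i 1) (EuclideanSpace.single j 1)

variable {n m d : ℕ}

/-- The directional derivative `DG(x) h`, computed entrywise. -/
def DG (p : NSDP n m d) (x h : EuclideanSpace ℝ (Fin n)) : Matrix (Fin d) (Fin d) ℝ :=
  Matrix.of fun i j => fderiv ℝ (fun z => p.G z i j) x h

/-- The partial derivative `G_i(x) = ∂G(x)/∂x_i`. -/
def partialG (p : NSDP n m d) (i : Fin n) (x : EuclideanSpace ℝ (Fin n)) :
    Matrix (Fin d) (Fin d) ℝ :=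
  p.DG x (EuclideanSpace.single i 1)

/-! ### Optimality conditions -/

/-- Feasibility: `g(x) = 0` and `G(x) ⪰ 0`. -/
def Feasible (p : NSDP n m d) (x : EuclideanSpace ℝ (Fin n)) : Prop :=
  p.g x = 0 ∧ (p.G x).PosSemidef

/-- The Lagrange function `L(x, y, Z) = f(x) - ⟨g(x), y⟩ - ⟨G(x), Z⟩`. -/
def lagrangian (p : NSDP n m d) (x : EuclideanSpace ℝ (Fin n)) (y : EuclideanSpace ℝ (Fin m))
    (Z : Matrix (Fin d) (Fin d) ℝ) : ℝ :=
  p.f x - inner ℝ (p.g x) y - matInner (p.G x) Z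

/-- The sigma-term, with entries `2 ⟨Z, G_i(x) G(x)† G_j(x)⟩`. -/
def sigmaTerm (p : NSDP n m d) (x : EuclideanSpace ℝ (Fin n)) (Z : Matrix (Fin d) (Fin d) ℝ) :
    Matrix (Fin n) (Fin n) ℝ :=
  Matrix.of fun i j => 2 * matInner Z (p.partialG i x * pinv (p.G x) * p.partialG j x)

/-- `{(x_k, y_k, Z_k)}` is an AKKT sequence corresponding to the point `xbar`. -/
def IsAKKTSeq (p : NSDP n m d) (xbar : EuclideanSpace ℝ (Fin n))
    (x : ℕ → EuclideanSpace ℝ (Fin n)) (y : ℕ → EuclideanSpace ℝ (Fin m))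
    (Z : ℕ → Matrix (Fin d) (Fin d) ℝ) : Prop :=
  (∀ k, (Z k).PosSemidef) ∧
  Tendsto x atTop (𝓝 xbar) ∧
  Tendsto (fun k => gradient (fun z => p.lagrangian z (y k) (Z k)) (x k)) atTop (𝓝 0) ∧
  ∃ (P : Matrix (Fin d) (Fin d) ℝ) (Q : ℕ → Matrix (Fin d) (Fin d) ℝ)
    (μ : Fin d → ℝ) (ζ : ℕ → Fin d → ℝ),
    P ∈ Matrix.orthogonalGroup (Fin d) ℝ ∧
    (∀ k, Q k ∈ Matrix.orthogonalGroup (Fin d) ℝ) ∧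
    Tendsto Q atTop (𝓝 P) ∧
    p.G xbar = P * Matrix.diagonal μ * P.transpose ∧
    (∀ k, Z k = Q k * Matrix.diagonal (ζ k) * (Q k).transpose) ∧
    ∀ j, 0 < μ j → ∃ K, ∀ k ≥ K, ζ k j = 0

/-- `{(x_k, y_k, Z_k)}` is a CAKKT sequence corresponding to the point `xbar`. -/
def IsCAKKTSeq (p : NSDP n m d) (xbar : EuclideanSpace ℝ (Fin n))
    (x : ℕ → EuclideanSpace ℝ (Fin n)) (y : ℕ → EuclideanSpace ℝ (Fin m))
    (Z : ℕ → Matrix (Fin d) (Fin d) ℝ) : Prop :=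
  (∀ k, (Z k).PosSemidef) ∧
  Tendsto x atTop (𝓝 xbar) ∧
  Tendsto (fun k => gradient (fun z => p.lagrangian z (y k) (Z k)) (x k)) atTop (𝓝 0) ∧
  Tendsto (fun k => symProd (p.G (x k)) (Z k)) atTop (𝓝 0)

/-- The columns of `V` form an orthonormal basis of a space spanned by eigenvectors associated
with the `r` smallest eigenvalues of the symmetric matrix `A`: here `A = Q diag(μ) Qᵀ` is an
orthogonal diagonalization with the eigenvalues `μ` in descending order. -/
def IsSmallestEigenbasis (A : Matrix (Fin d) (Fin d) ℝ) (r : ℕ)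
    (V : Matrix (Fin d) (Fin r) ℝ) : Prop :=
  V.transpose * V = 1 ∧
  ∃ (Q : Matrix (Fin d) (Fin d) ℝ) (μ : Fin d → ℝ),
    Q ∈ Matrix.orthogonalGroup (Fin d) ℝ ∧ Antitone μ ∧
    A = Q * Matrix.diagonal μ * Q.transpose ∧
    Submodule.span ℝ (Set.range V.col) = Submodule.span ℝ (Q.col '' {j | d - r ≤ (j : ℕ)})

/-- The perturbed critical subspace `S(x, xbar)`: all `h` with `∇g(x)ᵀ h = 0` and
`Uᵀ (DG(x) h) U = 0`, where the columns of `U` form an orthonormal basis of the space spanned by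
the eigenvectors for the `r` smallest eigenvalues of `G(x)` and `r = dim Ker G(xbar)`. For `x`
close to a feasible `xbar` that space is unique, and the condition depends only on the space and
not on its basis `U`. -/
def perturbedCriticalSubspace (p : NSDP n m d) (xbar x : EuclideanSpace ℝ (Fin n)) :
    Set (EuclideanSpace ℝ (Fin n)) :=
  {h | fderiv ℝ p.g x h = 0 ∧
    ∃ U : Matrix (Fin d)
        (Fin (Module.finrank ℝ (LinearMap.ker (Matrix.toLin' (p.G xbar))))) ℝ,
      IsSmallestEigenbasis (p.G x) _ U ∧ U.transpose * p.DG x h * U = 0}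

/-- The second-order part that the AKKT2 and the CAKKT2 conditions have in common. -/
def SecondOrderSeq (p : NSDP n m d) (xbar : EuclideanSpace ℝ (Fin n))
    (x : ℕ → EuclideanSpace ℝ (Fin n)) (y : ℕ → EuclideanSpace ℝ (Fin m))
    (Z : ℕ → Matrix (Fin d) (Fin d) ℝ) (ε : ℕ → ℝ) : Prop :=
  (∀ k, 0 < ε k) ∧ Tendsto ε atTop (𝓝 0) ∧
  ∃ N : ℕ, ∀ k ≥ N, ∀ h ∈ p.perturbedCriticalSubspace xbar (x k),
    - ε k * ‖h‖ ^ 2 ≤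
      h.ofLp ⬝ᵥ ((hessian (fun z => p.lagrangian z (y k) (Z k)) (x k) +
        p.sigmaTerm (x k) (Z k)).mulVec h.ofLp)

/-- `{(x_k, y_k, Z_k, ε_k)}` is an AKKT2 sequence corresponding to the point `xbar`. -/
def IsAKKT2Seq (p : NSDP n m d) (xbar : EuclideanSpace ℝ (Fin n))
    (x : ℕ → EuclideanSpace ℝ (Fin n)) (y : ℕ → EuclideanSpace ℝ (Fin m))
    (Z : ℕ → Matrix (Fin d) (Fin d) ℝ) (ε : ℕ → ℝ) : Prop :=
  p.IsAKKTSeq xbar x y Z ∧ p.SecondOrderSeq xbar x y Z ε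

/-- `xbar` is an AKKT2 point. -/
def IsAKKT2Point (p : NSDP n m d) (xbar : EuclideanSpace ℝ (Fin n)) : Prop :=
  p.Feasible xbar ∧ ∃ x y Z ε, p.IsAKKT2Seq xbar x y Z ε

/-- `{(x_k, y_k, Z_k, ε_k)}` is a CAKKT2 sequence corresponding to the point `xbar`. -/
def IsCAKKT2Seq (p : NSDP n m d) (xbar : EuclideanSpace ℝ (Fin n))
    (x : ℕ → EuclideanSpace ℝ (Fin n)) (y : ℕ → EuclideanSpace ℝ (Fin m))
    (Z : ℕ → Matrix (Fin d) (Fin d) ℝ) (ε : ℕ → ℝ) : Prop :=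
  p.IsCAKKTSeq xbar x y Z ∧ p.SecondOrderSeq xbar x y Z ε

/-- `xbar` is a CAKKT2 point. -/
def IsCAKKT2Point (p : NSDP n m d) (xbar : EuclideanSpace ℝ (Fin n)) : Prop :=
  p.Feasible xbar ∧ ∃ x y Z ε, p.IsCAKKT2Seq xbar x y Z ε

/-! ### The penalty method -/

/-- The infeasibility measure `½ ‖g(x)‖² + ¼ tr([-G(x)]₊⁴)`. -/
def infeasibility (p : NSDP n m d) (x : EuclideanSpace ℝ (Fin n)) : ℝ :=
  1 / 2 * ‖p.g x‖ ^ 2 + 1 / 4 * (matPos (-p.G x) ^ 4).trace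

/-- The penalty function `f(x) + (γ/2) ‖g(x)‖² + (γ/4) tr([-G(x)]₊⁴)`. -/
def penalty (p : NSDP n m d) (γ : ℝ) (x : EuclideanSpace ℝ (Fin n)) : ℝ :=
  p.f x + γ / 2 * ‖p.g x‖ ^ 2 + γ / 4 * (matPos (-p.G x) ^ 4).trace

/-- The generalized Polyak-Lojasiewicz inequality at `xbar`. Only the values of `Ψ` on the closed
ball matter. -/
def GeneralizedPL (p : NSDP n m d) (xbar : EuclideanSpace ℝ (Fin n)) : Prop :=
  ∃ ν > 0, ∃ Ψ : EuclideanSpace ℝ (Fin n) → ℝ,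
    Tendsto Ψ (𝓝[≠] xbar) (𝓝 0) ∧
    ∀ x ∈ Metric.closedBall xbar ν,
      |p.infeasibility x - p.infeasibility xbar| ≤ Ψ x * ‖gradient p.infeasibility x‖

/-- The measure `max {‖g(x)‖, ‖[-G(x)]₊‖_F}` used in the update of the penalty parameter. -/
def violation (p : NSDP n m d) (x : EuclideanSpace ℝ (Fin n)) : ℝ :=
  max ‖p.g x‖ (frobNorm (matPos (-p.G x)))

/-- The sequences `x` (iterates), `xhat` (starting points for the subproblems), `γ` (penalty
parameters) and `δ` (tolerances) are generated by the penalty method with the parameters `η`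
and `θ`. The subproblem solver is a descent method started at `xhat k` (a trust region method
accepts only steps that decrease the objective), which is what `descent` records. -/
structure IsPenaltyRun (p : NSDP n m d) (η θ : ℝ) (δ γ : ℕ → ℝ)
    (x xhat : ℕ → EuclideanSpace ℝ (Fin n)) : Prop where
  eta_mem : η ∈ Set.Ioo (0 : ℝ) 1
  one_lt_theta : 1 < θ
  delta_mem : ∀ k, δ k ∈ Set.Ioo (0 : ℝ) 1
  delta_tendsto : Tendsto δ atTop (𝓝 0)
  feasible_zero : p.Feasible (x 0)
  xhat_zero : xhat 0 = x 0
  gamma_zero : 0 < γ 0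
  descent : ∀ k, p.penalty (γ k) (x (k + 1)) ≤ p.penalty (γ k) (xhat k)
  gradient_le : ∀ k, ‖gradient (p.penalty (γ k)) (x (k + 1))‖ ≤ δ k
  hessian_posSemidef : ∀ k,
    (hessian (p.penalty (γ k)) (x (k + 1)) + δ k • (1 : Matrix (Fin n) (Fin n) ℝ)).PosSemidef
  xhat_succ : ∀ k,
    xhat (k + 1) = if p.penalty (γ k) (x (k + 1)) ≤ p.f (x 0) then x (k + 1) else x 0
  gamma_succ : ∀ k,
    γ (k + 1) =
      if k = 0 ∨ p.violation (x (k + 1)) ≤ η * p.violation (x k) then γ k else θ * γ k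

end

end NSDP

/-! The multipliers are the derivatives of the penalty term, so ∇ₓL(x_k, y_k, Z_k) is exactly the
gradient of the penalty function at x_k (`gradient_lagrangian_eq`), and it tends to zero by the
stopping rule.

For the second-order part, let G(x) = Q diag(μ) Qᵀ and K = Qᵀ(DG(x)h)Q. The penalty Hessian exceeds
the Lagrangian one, as a quadratic form, by γ‖Dg(x)h‖² + γ ∑ D(-μ_i, -μ_j) K_ij², where D is the
divided difference of t ↦ max(t, 0)³ (`dotProduct_hessian_penalty`). This rests on the
Daleckii-Krein formula, proved here as a first-order expansion with quadratic remainder. The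
sigma-term is a sum over the same squares, with coefficients γ(max(-μ_i, 0)³/μ_j + max(-μ_j,
0)³/μ_i) after symmetrization. On the perturbed critical subspace Dg(x)h = 0, and K vanishes on the
block of the smallest eigenvalues; every other pair contains an eigenvalue that is positive near x̄.
For such a pair a scalar inequality (`posPowDivDiff_neg_le`) shows that the sigma-term dominates, so
the curvature bound for the penalty function passes to L plus the sigma-term.

Accumulation points are feasible (`tendsto_infeasibility`): either γ_k → ∞, while restarts at the
feasible x₀ keep the penalty values bounded, or the violation eventually decays geometrically.

Z_k has the eigenvectors of G(x_k). Along a subsequence these converge to eigenvectors of G(x̄), and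
a positive limit eigenvalue forces the matching eigenvalue of Z_k to vanish: this is AKKT2. Under
the Polyak-Łojasiewicz inequality γ𝒫 ≤ Ψ‖γ∇𝒫‖, where γ∇𝒫 converges to -∇f(x̄) and Ψ → 0. Hence γ𝒫 →
0, which bounds G(x_k) ⊚ Z_k and gives CAKKT2 without a further subsequence. -/

namespace NSDP

/-! ### Orthogonal diagonalizations -/

/-- `X = Q diag(l) Qᵀ` with an orthogonal matrix `Q`. -/
structure IsDiagonalization {d : ℕ} (X Q : Matrix (Fin d) (Fin d) ℝ) (l : Fin d → ℝ) : Prop where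
  mem : Q ∈ Matrix.orthogonalGroup (Fin d) ℝ
  eq : X = Q * Matrix.diagonal l * Q.transpose

variable {d : ℕ} {X Y Q R : Matrix (Fin d) (Fin d) ℝ} {l t : Fin d → ℝ}

theorem transpose_mul_self_of_mem (hQ : Q ∈ Matrix.orthogonalGroup (Fin d) ℝ) :
    Q.transpose * Q = 1 :=
  (Matrix.mem_orthogonalGroup_iff' _ _).1 hQ

theorem mul_transpose_self_of_mem (hQ : Q ∈ Matrix.orthogonalGroup (Fin d) ℝ) :
    Q * Q.transpose = 1 :=
  (Matrix.mem_orthogonalGroup_iff _ _).1 hQ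

theorem transpose_mem (hQ : Q ∈ Matrix.orthogonalGroup (Fin d) ℝ) :
    Q.transpose ∈ Matrix.orthogonalGroup (Fin d) ℝ := by
  rw [Matrix.mem_orthogonalGroup_iff, Matrix.transpose_transpose]
  exact transpose_mul_self_of_mem hQ

theorem abs_entry_le_one (hQ : Q ∈ Matrix.orthogonalGroup (Fin d) ℝ) (i j : Fin d) :
    |Q i j| ≤ 1 := entry_norm_bound_of_unitary hQ i j

theorem exists_isDiagonalization (hX : X.IsSymm) :
    ∃ (Q : Matrix (Fin d) (Fin d) ℝ) (l : Fin d → ℝ), IsDiagonalization X Q l := by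
  have hH : X.IsHermitian := by
    rw [Matrix.IsHermitian, Matrix.conjTranspose_eq_transpose_of_trivial]; exact hX
  refine ⟨hH.eigenvectorUnitary, hH.eigenvalues, hH.eigenvectorUnitary.2, ?_⟩
  conv_lhs => rw [hH.spectral_theorem]
  rw [Unitary.conjStarAlgAut_apply, Matrix.star_eq_conjTranspose,
    Matrix.conjTranspose_eq_transpose_of_trivial]
  rfl

namespace IsDiagonalization

theorem isSymm (h : IsDiagonalization X Q l) : X.IsSymm := by
  rw [h.eq, Matrix.IsSymm, Matrix.transpose_mul, Matrix.transpose_mul, Matrix.transpose_transpose,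
    Matrix.diagonal_transpose, Matrix.mul_assoc]

theorem neg (h : IsDiagonalization X Q l) : IsDiagonalization (-X) Q (fun i => -l i) := by
  refine ⟨h.mem, ?_⟩
  have : Matrix.diagonal (fun i => -l i) = -Matrix.diagonal l := (Matrix.diagonal_neg l).symm
  rw [this, h.eq, Matrix.mul_neg, Matrix.neg_mul]

theorem conj_eq (h : IsDiagonalization X Q l) :
    Q.transpose * X * Q = Matrix.diagonal l := by
  have h1 := transpose_mul_self_of_mem h.mem
  calc Q.transpose * X * Q = (Q.transpose * Q) * Matrix.diagonal l * (Q.transpose * Q) := by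
        rw [h.eq]; simp only [Matrix.mul_assoc]
    _ = _ := by rw [h1, Matrix.one_mul, Matrix.mul_one]

theorem mul (h : IsDiagonalization X Q l) (h' : IsDiagonalization Y Q t) :
    IsDiagonalization (X * Y) Q (fun i => l i * t i) := by
  refine ⟨h.mem, ?_⟩
  calc X * Y = Q * Matrix.diagonal l * (Q.transpose * Q) * Matrix.diagonal t * Q.transpose := by
        rw [h.eq, h'.eq]; simp only [Matrix.mul_assoc]
    _ = _ := by
      rw [transpose_mul_self_of_mem h.mem, Matrix.mul_one, Matrix.mul_assoc Q,
        Matrix.diagonal_mul_diagonal]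

theorem one (hQ : Q ∈ Matrix.orthogonalGroup (Fin d) ℝ) :
    IsDiagonalization 1 Q (fun _ => 1) := by
  refine ⟨hQ, ?_⟩
  rw [Matrix.diagonal_one, Matrix.mul_one, mul_transpose_self_of_mem hQ]

theorem pow (h : IsDiagonalization X Q l) (k : ℕ) :
    IsDiagonalization (X ^ k) Q (fun i => l i ^ k) := by
  induction k with
  | zero => simpa using one h.mem
  | succ k ih => simpa only [pow_succ] using ih.mul h

theorem smul (h : IsDiagonalization X Q l) (c : ℝ) :
    IsDiagonalization (c • X) Q (fun i => c * l i) := by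
  refine ⟨h.mem, ?_⟩
  have : Matrix.diagonal (c • l) = c • Matrix.diagonal l :=
    Matrix.diagonal_smul c l
  change c • X = Q * Matrix.diagonal (c • l) * Q.transpose
  rw [this, h.eq, Matrix.mul_smul, Matrix.smul_mul]

theorem add (h : IsDiagonalization X Q l) (h' : IsDiagonalization Y Q t) :
    IsDiagonalization (X + Y) Q (fun i => l i + t i) := by
  refine ⟨h.mem, ?_⟩
  rw [h.eq, h'.eq, ← Matrix.diagonal_add, Matrix.mul_add, Matrix.add_mul]

theorem aeval (h : IsDiagonalization X Q l) (q : Polynomial ℝ) :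
    IsDiagonalization (Polynomial.aeval X q) Q (fun i => q.eval (l i)) := by
  induction q using Polynomial.induction_on' with
  | add q r hq hr => simpa only [map_add, Polynomial.eval_add] using hq.add hr
  | monomial n a =>
    simpa only [Polynomial.aeval_monomial, Polynomial.eval_monomial, Algebra.algebraMap_eq_smul_one,
      smul_mul_assoc, one_mul] using (h.pow n).smul a

/-- No continuity is needed: on finitely many nodes every function is a polynomial. The nodes
contain both the spectrum and the values of `l`, so the two need not be compared. -/
theorem cfc (h : IsDiagonalization X Q l) (f : ℝ → ℝ) :
    IsDiagonalization (cfc f X) Q (fun i => f (l i)) := by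
  classical
  have hs : IsSelfAdjoint X := by
    show star X = X
    rw [Matrix.star_eq_conjTranspose, Matrix.conjTranspose_eq_transpose_of_trivial]
    exact h.isSymm
  set s : Finset ℝ := (Matrix.finite_real_spectrum (A := X)).toFinset ∪ Finset.univ.image l
  set q : Polynomial ℝ := Lagrange.interpolate s id f
  have hq : ∀ a ∈ s, q.eval a = f a := fun a ha =>
    Lagrange.eval_interpolate_at_node f (Set.injOn_id _) ha
  have h1 : _root_.cfc f X = Polynomial.aeval X q := by
    rw [← cfc_polynomial q X hs]
    refine cfc_congr fun a ha => (hq a ?_).symm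
    simp [s, ha]
  have h2 : (fun i => f (l i)) = fun i => q.eval (l i) := by
    funext i
    exact (hq _ (by simp [s])).symm
  rw [h1, h2]
  exact h.aeval q

theorem matPos (h : IsDiagonalization X Q l) :
    IsDiagonalization (matPos X) Q (fun i => max (l i) 0) := h.cfc _

theorem pinv (h : IsDiagonalization X Q l) :
    IsDiagonalization (pinv X) Q (fun i => (l i)⁻¹) := h.cfc _

theorem trace (h : IsDiagonalization X Q l) : X.trace = ∑ i, l i := by
  rw [h.eq, Matrix.trace_mul_comm, ← Matrix.mul_assoc, transpose_mul_self_of_mem h.mem,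
    Matrix.one_mul, Matrix.trace_diagonal]

theorem posSemidef (h : IsDiagonalization X Q l) (hl : ∀ i, 0 ≤ l i) : X.PosSemidef := by
  have := (Matrix.PosSemidef.diagonal (n := Fin d) (R := ℝ) (d := l) hl).mul_mul_conjTranspose_same Q
  rwa [Matrix.conjTranspose_eq_transpose_of_trivial, ← h.eq] at this

theorem apply (h : IsDiagonalization X Q l) (i j : Fin d) :
    X i j = ∑ k, Q i k * l k * Q j k := by
  rw [h.eq, Matrix.mul_apply]
  simp [Matrix.mul_diagonal]

theorem abs_apply_le (h : IsDiagonalization X Q l) (i j : Fin d) : |X i j| ≤ ∑ k, |l k| := by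
  rw [h.apply]
  refine (Finset.abs_sum_le_sum_abs _ _).trans (Finset.sum_le_sum fun k _ => ?_)
  rw [abs_mul, abs_mul]
  have h1 := abs_entry_le_one h.mem i k
  have h2 := abs_entry_le_one h.mem j k
  calc |Q i k| * |l k| * |Q j k| ≤ 1 * |l k| * 1 := by gcongr
    _ = |l k| := by ring

theorem nonneg (h : IsDiagonalization X Q l) (hX : X.PosSemidef) (i : Fin d) : 0 ≤ l i := by
  have := (hX.conjTranspose_mul_mul_same Q).diag_nonneg (i := i)
  rw [Matrix.conjTranspose_eq_transpose_of_trivial, h.conj_eq] at this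
  simpa using this

end IsDiagonalization

/-! ### The sum of the absolute values of the entries -/

/-- The sum of the absolute values of the entries. -/
def entrySum (H : Matrix (Fin d) (Fin d) ℝ) : ℝ := ∑ i, ∑ j, |H i j|

theorem entrySum_nonneg (H : Matrix (Fin d) (Fin d) ℝ) : 0 ≤ entrySum H :=
  Finset.sum_nonneg fun _ _ => Finset.sum_nonneg fun _ _ => abs_nonneg _

theorem abs_mul_mul_apply_le {A B H : Matrix (Fin d) (Fin d) ℝ} (hA : ∀ i j, |A i j| ≤ 1)
    (hB : ∀ i j, |B i j| ≤ 1) (i j : Fin d) : |(A * H * B) i j| ≤ entrySum H := by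
  have h1 : (A * H * B) i j = ∑ k, ∑ m, A i m * H m k * B k j := by
    rw [Matrix.mul_apply]
    exact Finset.sum_congr rfl fun k _ => by rw [Matrix.mul_apply, Finset.sum_mul]
  rw [h1, Finset.sum_comm]
  refine (Finset.abs_sum_le_sum_abs _ _).trans (Finset.sum_le_sum fun m _ => ?_)
  refine (Finset.abs_sum_le_sum_abs _ _).trans (Finset.sum_le_sum fun k _ => ?_)
  rw [abs_mul, abs_mul]
  calc |A i m| * |H m k| * |B k j| ≤ 1 * |H m k| * 1 := by gcongr <;> simp [hA, hB]
    _ = |H m k| := by ring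

/-! ### First order expansion of spectral functions -/

/-- The Daleckii-Krein operator `H ↦ Q (D ∘ Qᵀ H Q) Qᵀ` with the entrywise product by
`D (l i) (l j)`. -/
def daleckiiKrein (D : ℝ → ℝ → ℝ) (Q : Matrix (Fin d) (Fin d) ℝ) (l : Fin d → ℝ)
    (H : Matrix (Fin d) (Fin d) ℝ) : Matrix (Fin d) (Fin d) ℝ :=
  Q * (Matrix.of fun i j => D (l i) (l j) * (Q.transpose * H * Q) i j) * Q.transpose

/-- The remainder is read between the two eigenbases, as Rᵀ E Q. With W = RᵀQ its entries are sums
of W_ac (D(t_a, l_b) - D(l_c, l_b)) M_cb. The Lipschitz bound yields a factor t_a - l_c, and W_ac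
(t_a - l_c) is an entry of RᵀHQ, so each summand is quadratic in H. The eigenvectors of X and Y need
not be close. -/
theorem abs_cfc_sub_sub_daleckiiKrein_le {f : ℝ → ℝ} {D : ℝ → ℝ → ℝ} {B K : ℝ}
    (hD : ∀ a b, D a b * (a - b) = f a - f b) (hK : 0 ≤ K)
    (hLip : ∀ a b c, |a| ≤ B → |b| ≤ B → |c| ≤ B → |D a b - D c b| ≤ K * |a - c|)
    (hX : IsDiagonalization X Q l) (hY : IsDiagonalization Y R t)
    (hl : ∀ i, |l i| ≤ B) (ht : ∀ i, |t i| ≤ B) (i j : Fin d) :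
    |(cfc f Y - cfc f X - daleckiiKrein D Q l (Y - X)) i j| ≤
      d ^ 3 * K * entrySum (Y - X) ^ 2 := by
  set H := Y - X with hH
  set W := R.transpose * Q with hW
  set E := cfc f Y - cfc f X - daleckiiKrein D Q l H with hE
  set M := Q.transpose * H * Q with hM
  have hQ := transpose_mul_self_of_mem hX.mem
  have hQ' := mul_transpose_self_of_mem hX.mem
  have hR := transpose_mul_self_of_mem hY.mem
  have hR' := mul_transpose_self_of_mem hY.mem
  have hRH : R.transpose * H * Q = W * M := by
    rw [hW, hM]
    calc R.transpose * H * Q = R.transpose * (Q * Q.transpose) * H * Q := by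
          rw [hQ', Matrix.mul_one]
      _ = _ := by simp only [Matrix.mul_assoc]
  have hRH' : R.transpose * H * Q = Matrix.diagonal t * W - W * Matrix.diagonal l := by
    rw [hH, Matrix.mul_sub, Matrix.sub_mul]
    congr 1
    · calc R.transpose * Y * Q = R.transpose * R * Matrix.diagonal t * R.transpose * Q := by
            rw [hY.eq]; simp only [Matrix.mul_assoc]
        _ = _ := by rw [hR, Matrix.one_mul, hW, Matrix.mul_assoc]
    · calc R.transpose * X * Q = R.transpose * Q * Matrix.diagonal l * (Q.transpose * Q) := by
            rw [hX.eq]; simp only [Matrix.mul_assoc]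
        _ = _ := by rw [hQ, Matrix.mul_one]
  have hWapp : ∀ a b, (R.transpose * H * Q) a b = (t a - l b) * W a b := by
    intro a b
    rw [hRH', Matrix.sub_apply, Matrix.diagonal_mul, Matrix.mul_diagonal]; ring
  have hbound : ∀ a b, |(R.transpose * H * Q) a b| ≤ entrySum H := fun a b =>
    abs_mul_mul_apply_le (abs_entry_le_one (transpose_mem hY.mem)) (abs_entry_le_one hX.mem) a b
  have hMbound : ∀ a b, |M a b| ≤ entrySum H := fun a b =>
    abs_mul_mul_apply_le (abs_entry_le_one (transpose_mem hX.mem)) (abs_entry_le_one hX.mem) a b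
  have hS := entrySum_nonneg H
  have hREQ : ∀ a b, (R.transpose * E * Q) a b =
      ∑ c, W a c * (D (t a) (l b) - D (l c) (l b)) * M c b := by
    intro a b
    have e1 : R.transpose * E * Q = Matrix.diagonal (fun i => f (t i)) * W -
        W * Matrix.diagonal (fun i => f (l i)) -
        W * (Matrix.of fun i j => D (l i) (l j) * M i j) := by
      rw [hE, (hX.cfc f).eq, (hY.cfc f).eq, daleckiiKrein, Matrix.mul_sub, Matrix.mul_sub,
        Matrix.sub_mul, Matrix.sub_mul]
      congr 1
      · congr 1
        · calc _ = R.transpose * R * Matrix.diagonal (fun i => f (t i)) * (R.transpose * Q) := by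
                simp only [Matrix.mul_assoc]
            _ = _ := by rw [hR, Matrix.one_mul]
        · calc _ = R.transpose * Q * Matrix.diagonal (fun i => f (l i)) * (Q.transpose * Q) := by
                simp only [Matrix.mul_assoc]
            _ = _ := by rw [hQ, Matrix.mul_one]
      · calc _ = R.transpose * Q * (Matrix.of fun i j => D (l i) (l j) * M i j) *
                (Q.transpose * Q) := by simp only [Matrix.mul_assoc, hM]
          _ = _ := by rw [hQ, Matrix.mul_one]
    -- Write f(t_a) - f(l_b) as D(t_a, l_b)(t_a - l_b); then (t_a - l_b) W_ab is the (a, b) entry of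
    -- RᵀHQ = WM.
    have e2 : f (t a) * W a b - W a b * f (l b) = ∑ c, D (t a) (l b) * (W a c * M c b) := by
      rw [← Finset.mul_sum, ← Matrix.mul_apply, ← hRH, hWapp]
      linear_combination -W a b * hD (t a) (l b)
    rw [e1, Matrix.sub_apply, Matrix.sub_apply, Matrix.diagonal_mul, Matrix.mul_diagonal, e2,
      Matrix.mul_apply, ← Finset.sum_sub_distrib]
    exact Finset.sum_congr rfl fun c _ => by rw [Matrix.of_apply]; ring
  have hREQb : ∀ a b, |(R.transpose * E * Q) a b| ≤ d * (K * entrySum H ^ 2) := by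
    intro a b
    rw [hREQ]
    refine (Finset.abs_sum_le_sum_abs _ _).trans ?_
    have : ∀ c ∈ Finset.univ, |W a c * (D (t a) (l b) - D (l c) (l b)) * M c b| ≤
        K * entrySum H ^ 2 := by
      intro c _
      rw [abs_mul, abs_mul]
      calc |W a c| * |D (t a) (l b) - D (l c) (l b)| * |M c b|
          ≤ |W a c| * (K * |t a - l c|) * entrySum H := by
            gcongr
            · exact hLip _ _ _ (ht a) (hl b) (hl c)
            · exact hMbound c b
        _ = K * |(R.transpose * H * Q) a c| * entrySum H := by rw [hWapp, abs_mul]; ring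
        _ ≤ K * entrySum H * entrySum H := by gcongr; exact hbound a c
        _ = _ := by ring
    simpa using Finset.sum_le_sum this
  have hEeq : E = R * (R.transpose * E * Q) * Q.transpose := by
    calc E = (R * R.transpose) * E * (Q * Q.transpose) := by
          rw [hR', hQ', Matrix.one_mul, Matrix.mul_one]
      _ = _ := by simp only [Matrix.mul_assoc]
  rw [hEeq]
  refine (abs_mul_mul_apply_le (abs_entry_le_one hY.mem)
    (abs_entry_le_one (transpose_mem hX.mem)) i j).trans ?_
  -- One factor d comes from the sum over c, the other two from the sum of all entries.
  have : entrySum (R.transpose * E * Q) ≤ ∑ _i : Fin d, ∑ _j : Fin d, d * (K * entrySum H ^ 2) :=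
    Finset.sum_le_sum fun a _ => Finset.sum_le_sum fun b _ => hREQb a b
  refine this.trans (le_of_eq ?_)
  simp; ring

/-! ### Divided differences of powers of the positive part -/

theorem hasDerivAt_max_zero_pow (k : ℕ) (a : ℝ) :
    HasDerivAt (fun s : ℝ => max s 0 ^ (k + 2)) ((k + 2) * max a 0 ^ (k + 1)) a := by
  rcases lt_trichotomy a 0 with h | h | h
  · have : (fun s : ℝ => max s 0 ^ (k + 2)) =ᶠ[𝓝 a] fun _ => 0 := by
      filter_upwards [Iio_mem_nhds h] with s hs
      simp [max_eq_right (le_of_lt (Set.mem_Iio.1 hs))]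
    rw [max_eq_right h.le]
    simpa using (hasDerivAt_const a (0 : ℝ)).congr_of_eventuallyEq this
  · subst h
    rw [hasDerivAt_iff_isLittleO]
    -- At the kink the power is bounded by |s| ^ (k + 2), which is o(s).
    refine (Asymptotics.IsBigO.of_bound 1 ?_).trans_isLittleO
      (Asymptotics.isLittleO_pow_pow (m := 1) (n := k + 2) (by omega) |>.congr_right
        (g₁ := fun s : ℝ => s ^ 1) (g₂ := fun s => s - 0) (by simp))
    refine Eventually.of_forall fun s => ?_
    have : |max s 0| ≤ |s| := by
      rw [abs_of_nonneg (le_max_right _ _)]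
      exact max_le (le_abs_self s) (abs_nonneg s)
    simpa [abs_pow] using pow_le_pow_left₀ (abs_nonneg _) this (k + 2)
  · have : (fun s : ℝ => max s 0 ^ (k + 2)) =ᶠ[𝓝 a] fun s => s ^ (k + 2) := by
      filter_upwards [Ioi_mem_nhds h] with s hs
      rw [max_eq_left (le_of_lt (Set.mem_Ioi.1 hs))]
    rw [max_eq_left h.le]
    simpa using (hasDerivAt_pow (k + 2) a).congr_of_eventuallyEq this

/-- The divided difference of `s ↦ max s 0 ^ (k + 2)`. -/
noncomputable def posPowDivDiff (k : ℕ) (a b : ℝ) : ℝ :=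
  ∫ s in (0 : ℝ)..1, (k + 2) * max (b + s * (a - b)) 0 ^ (k + 1)

/-- Fundamental theorem of calculus along the segment from b to a. The integral form also gives the
derivative on the diagonal and makes the Lipschitz bound uniform, without separating a = b. -/
theorem posPowDivDiff_mul_sub (k : ℕ) (a b : ℝ) :
    posPowDivDiff k a b * (a - b) = max a 0 ^ (k + 2) - max b 0 ^ (k + 2) := by
  have h1 : ∀ s ∈ Set.uIcc (0 : ℝ) 1,
      HasDerivAt (fun s : ℝ => max (b + s * (a - b)) 0 ^ (k + 2))
        ((k + 2) * max (b + s * (a - b)) 0 ^ (k + 1) * (a - b)) s := by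
    intro s _
    have h2 : HasDerivAt (fun s : ℝ => b + s * (a - b)) (a - b) s := by
      simpa using ((hasDerivAt_id s).mul_const (a - b)).const_add b
    exact (hasDerivAt_max_zero_pow k (b + s * (a - b))).comp s h2
  have h3 := intervalIntegral.integral_eq_sub_of_hasDerivAt h1
    (Continuous.intervalIntegrable (by fun_prop) _ _)
  rw [intervalIntegral.integral_mul_const] at h3
  rw [posPowDivDiff, h3]
  simp

theorem posPowDivDiff_self (k : ℕ) (a : ℝ) :
    posPowDivDiff k a a = (k + 2) * max a 0 ^ (k + 1) := by
  simp [posPowDivDiff]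

theorem abs_posPowDivDiff_sub_le (k : ℕ) {a b c B : ℝ} (ha : |a| ≤ B) (hb : |b| ≤ B)
    (hc : |c| ≤ B) :
    |posPowDivDiff k a b - posPowDivDiff k c b| ≤ (k + 2) * (k + 1) * B ^ k * |a - c| := by
  have hB : 0 ≤ B := (abs_nonneg a).trans ha
  have hbd : ∀ e, |e| ≤ B → ∀ s ∈ Set.Icc (0 : ℝ) 1, |max (b + s * (e - b)) 0| ≤ B := by
    intro e he s hs
    rw [abs_of_nonneg (le_max_right _ _)]
    refine max_le ?_ hB
    have h1 := le_of_abs_le he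
    have h2 := le_of_abs_le hb
    nlinarith [hs.1, hs.2]
  rw [posPowDivDiff, posPowDivDiff, ← intervalIntegral.integral_sub
    (Continuous.intervalIntegrable (by fun_prop) _ _)
    (Continuous.intervalIntegrable (by fun_prop) _ _)]
  have := intervalIntegral.norm_integral_le_of_norm_le_const (a := (0 : ℝ)) (b := 1)
    (C := (k + 2) * (k + 1) * B ^ k * |a - c|)
    (f := fun s => (k + 2) * max (b + s * (a - b)) 0 ^ (k + 1) -
      (k + 2) * max (b + s * (c - b)) 0 ^ (k + 1)) ?_
  · simpa using this
  · intro s hs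
    rw [Set.uIoc_of_le zero_le_one] at hs
    have hs' : s ∈ Set.Icc (0 : ℝ) 1 := ⟨hs.1.le, hs.2⟩
    rw [← mul_sub, Real.norm_eq_abs, abs_mul, abs_of_nonneg (by positivity : (0 : ℝ) ≤ k + 2)]
    have h1 := abs_pow_sub_pow_le (max (b + s * (a - b)) 0) (max (b + s * (c - b)) 0) (k + 1)
    have h2 : |max (b + s * (a - b)) 0 - max (b + s * (c - b)) 0| ≤ |a - c| := by
      refine (abs_max_sub_max_le_abs _ _ _).trans ?_
      have : b + s * (a - b) - (b + s * (c - b)) = s * (a - c) := by ring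
      rw [this, abs_mul, abs_of_nonneg hs'.1]
      exact mul_le_of_le_one_left (abs_nonneg _) hs'.2
    have h3 : max |max (b + s * (a - b)) 0| |max (b + s * (c - b)) 0| ≤ B :=
      max_le (hbd a ha s hs') (hbd c hc s hs')
    calc ((k : ℝ) + 2) * |max (b + s * (a - b)) 0 ^ (k + 1) - max (b + s * (c - b)) 0 ^ (k + 1)|
        ≤ (k + 2) * (|a - c| * (k + 1 : ℕ) * B ^ k) := by
          gcongr
          refine h1.trans ?_
          rw [Nat.add_sub_cancel]
          gcongr
      _ = _ := by push_cast; ring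

theorem posPowDivDiff_of_nonpos (k : ℕ) {a b : ℝ} (ha : a ≤ 0) (hb : b ≤ 0) :
    posPowDivDiff k a b = 0 := by
  rcases eq_or_ne a b with h | h
  · subst h; simp [posPowDivDiff_self, max_eq_right ha]
  · have := posPowDivDiff_mul_sub k a b
    rw [max_eq_right ha, max_eq_right hb, sub_self] at this
    exact (mul_eq_zero.1 this).resolve_right (sub_ne_zero.2 h)

theorem posPowDivDiff_comm (k : ℕ) (a b : ℝ) : posPowDivDiff k a b = posPowDivDiff k b a := by
  rcases eq_or_ne a b with h | h
  · rw [h]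
  · have h1 := posPowDivDiff_mul_sub k a b
    have h2 := posPowDivDiff_mul_sub k b a
    refine mul_right_cancel₀ (sub_ne_zero.2 h) ?_
    linear_combination h1 + h2

/-! ### Derivatives of spectral functions along a curve of symmetric matrices -/

section SpectralDerivative

variable {d : ℕ} {F : Type*} [NormedAddCommGroup F] [NormedSpace ℝ F]

theorem daleckiiKrein_add (D : ℝ → ℝ → ℝ) (Q : Matrix (Fin d) (Fin d) ℝ) (l : Fin d → ℝ)
    (H K : Matrix (Fin d) (Fin d) ℝ) :
    daleckiiKrein D Q l (H + K) = daleckiiKrein D Q l H + daleckiiKrein D Q l K := by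
  rw [daleckiiKrein, daleckiiKrein, daleckiiKrein, ← Matrix.add_mul, ← Matrix.mul_add]
  congr 2
  ext i j
  simp only [Matrix.add_mul, Matrix.of_apply, Matrix.add_apply, mul_add]

theorem daleckiiKrein_smul (D : ℝ → ℝ → ℝ) (Q : Matrix (Fin d) (Fin d) ℝ) (l : Fin d → ℝ)
    (c : ℝ) (H : Matrix (Fin d) (Fin d) ℝ) :
    daleckiiKrein D Q l (c • H) = c • daleckiiKrein D Q l H := by
  rw [daleckiiKrein, daleckiiKrein, ← Matrix.smul_mul, ← Matrix.mul_smul]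
  congr 2
  ext i j
  simp only [Matrix.mul_smul, Matrix.smul_mul, Matrix.of_apply, Matrix.smul_apply, smul_eq_mul]
  ring

/-- An entry of the Daleckii-Krein operator as a linear functional. -/
def daleckiiKreinEntry (D : ℝ → ℝ → ℝ) (Q : Matrix (Fin d) (Fin d) ℝ) (l : Fin d → ℝ)
    (i j : Fin d) : Matrix (Fin d) (Fin d) ℝ →ₗ[ℝ] ℝ where
  toFun H := daleckiiKrein D Q l H i j
  map_add' H K := by rw [daleckiiKrein_add, Matrix.add_apply]
  map_smul' c H := by rw [daleckiiKrein_smul, Matrix.smul_apply, RingHom.id_apply]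

theorem linearMap_apply_eq_sum (φ : Matrix (Fin d) (Fin d) ℝ →ₗ[ℝ] ℝ)
    (H : Matrix (Fin d) (Fin d) ℝ) :
    φ H = ∑ a, ∑ b, φ (Matrix.single a b 1) * H a b := by
  conv_lhs => rw [Matrix.matrix_eq_sum_single H]
  simp only [map_sum]
  refine Finset.sum_congr rfl fun a _ => Finset.sum_congr rfl fun b _ => ?_
  have : Matrix.single a b (H a b) = H a b • Matrix.single a b (1 : ℝ) := by
    rw [Matrix.smul_single, smul_eq_mul, mul_one]
  rw [this, map_smul, smul_eq_mul, mul_comm]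

theorem exists_hasFDerivAt_linearMap_comp (φ : Matrix (Fin d) (Fin d) ℝ →ₗ[ℝ] ℝ)
    {A : F → Matrix (Fin d) (Fin d) ℝ} {A' : Fin d → Fin d → F →L[ℝ] ℝ} {x : F}
    (hA : ∀ a b, HasFDerivAt (fun z => A z a b) (A' a b) x) :
    ∃ L : F →L[ℝ] ℝ, (∀ h, L h = φ (Matrix.of fun a b => A' a b h)) ∧
      HasFDerivAt (fun z => φ (A z)) L x := by
  refine ⟨∑ a, ∑ b, φ (Matrix.single a b 1) • A' a b, fun h => ?_, ?_⟩
  · rw [linearMap_apply_eq_sum φ]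
    simp
  · have : (fun z => φ (A z)) = fun z => ∑ a, ∑ b, φ (Matrix.single a b 1) * A z a b :=
      funext fun z => linearMap_apply_eq_sum φ (A z)
    rw [this]
    exact HasFDerivAt.fun_sum fun a _ => HasFDerivAt.fun_sum fun b _ => (hA a b).const_mul _

theorem IsDiagonalization.abs_le_entrySum {X Q : Matrix (Fin d) (Fin d) ℝ} {l : Fin d → ℝ}
    (h : IsDiagonalization X Q l) (i : Fin d) : |l i| ≤ entrySum X := by
  have h1 : (Q.transpose * X * Q) i i = l i := by rw [h.conj_eq, Matrix.diagonal_apply_eq]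
  rw [← h1]
  exact abs_mul_mul_apply_le (abs_entry_le_one (transpose_mem h.mem)) (abs_entry_le_one h.mem) i i

theorem matPos_pow_eq_cfc {X : Matrix (Fin d) (Fin d) ℝ} (hX : X.IsSymm) (k : ℕ) :
    matPos X ^ k = cfc (fun s : ℝ => max s 0 ^ k) X := by
  obtain ⟨Q, l, h⟩ := exists_isDiagonalization hX
  rw [(h.matPos.pow k).eq, (h.cfc _).eq]

/-- Split the increment into the Daleckii-Krein functional of A z - A x, which is linear in the
entries of A, and a remainder of order ‖z - x‖², whose derivative is zero. -/
theorem exists_hasFDerivAt_matPos_pow (k : ℕ) {A : F → Matrix (Fin d) (Fin d) ℝ}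
    {A' : Fin d → Fin d → F →L[ℝ] ℝ} {x : F} (hsymm : ∀ z, (A z).IsSymm)
    (hA : ∀ a b, HasFDerivAt (fun z => A z a b) (A' a b) x)
    {Q : Matrix (Fin d) (Fin d) ℝ} {l : Fin d → ℝ} (hx : IsDiagonalization (A x) Q l)
    (i j : Fin d) :
    ∃ L : F →L[ℝ] ℝ,
      (∀ h, L h = daleckiiKrein (posPowDivDiff k) Q l (Matrix.of fun a b => A' a b h) i j) ∧
      HasFDerivAt (fun z => (matPos (A z) ^ (k + 2)) i j) L x := by
  set φ := daleckiiKreinEntry (posPowDivDiff k) Q l i j with hφ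
  obtain ⟨L, hL, hL'⟩ := exists_hasFDerivAt_linearMap_comp φ hA
  refine ⟨L, hL, ?_⟩
  -- The extra 1 makes B a bound for the eigenvalues of all A z with z near x, so one Lipschitz
  -- constant serves the whole neighbourhood.
  set B := entrySum (A x) + 1
  have hB : 0 ≤ B := by have := entrySum_nonneg (A x); positivity
  set K : ℝ := (k + 2) * (k + 1) * B ^ k
  have hcont : ContinuousAt (fun z => entrySum (A z)) x :=
    tendsto_finsetSum _ fun a _ => tendsto_finsetSum _ fun b _ => (hA a b).continuousAt.abs
  have hev : ∀ᶠ z in 𝓝 x, entrySum (A z) < B :=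
    hcont.eventually (gt_mem_nhds (lt_add_one (entrySum (A x))))
  have hO : (fun z => entrySum (A z - A x)) =O[𝓝 x] fun z => ‖z - x‖ :=
    Asymptotics.IsBigO.fun_sum fun a _ => Asymptotics.IsBigO.fun_sum fun b _ =>
      (hA a b).isBigO_sub.norm_norm
  have hr : (fun z => (matPos (A z) ^ (k + 2)) i j - (matPos (A x) ^ (k + 2)) i j -
      φ (A z - A x)) =O[𝓝 x] fun z => ‖z - x‖ ^ 2 := by
    refine Asymptotics.IsBigO.trans (Asymptotics.IsBigO.of_bound (d ^ 3 * K) ?_) (hO.pow 2)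
    filter_upwards [hev] with z hz
    obtain ⟨R, t, hzd⟩ := exists_isDiagonalization (hsymm z)
    have := abs_cfc_sub_sub_daleckiiKrein_le (B := B) (posPowDivDiff_mul_sub k)
      (by positivity : 0 ≤ K) (fun a b c ha hb hc => abs_posPowDivDiff_sub_le k ha hb hc) hx hzd
      (fun i => (hx.abs_le_entrySum i).trans (lt_add_one _).le)
      (fun i => (hzd.abs_le_entrySum i).trans hz.le) i j
    rw [← matPos_pow_eq_cfc (hsymm z), ← matPos_pow_eq_cfc (hsymm x)] at this
    rw [Real.norm_eq_abs, Real.norm_eq_abs, abs_of_nonneg (sq_nonneg (entrySum _))]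
    exact this
  have h1 := ((hr.hasFDerivAt one_lt_two).add hL').add_const
    ((matPos (A x) ^ (k + 2)) i j - φ (A x))
  rw [zero_add] at h1
  refine h1.congr_of_eventuallyEq (Eventually.of_forall fun z => ?_)
  simp only [Pi.add_apply, map_sub]
  ring

/-- Conjugation by Q preserves the trace, so only the diagonal values D(a, a), that is the scalar
derivative, contribute. -/
theorem trace_daleckiiKrein {X Q H : Matrix (Fin d) (Fin d) ℝ} {l : Fin d → ℝ}
    {D : ℝ → ℝ → ℝ} {u : ℝ → ℝ} (hD : ∀ a, D a a = u a)
    (hX : IsDiagonalization X Q fun i => u (l i)) :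
    (daleckiiKrein D Q l H).trace = (X * H).trace := by
  have h1 : (X * H).trace = (Matrix.diagonal (fun i => u (l i)) * (Q.transpose * H * Q)).trace := by
    calc (X * H).trace = (Q * (Matrix.diagonal (fun i => u (l i)) * Q.transpose * H)).trace := by
          rw [hX.eq]; simp only [Matrix.mul_assoc]
      _ = _ := by rw [Matrix.trace_mul_comm]; simp only [Matrix.mul_assoc]
  rw [h1, daleckiiKrein, Matrix.trace_mul_comm, ← Matrix.mul_assoc,
    transpose_mul_self_of_mem hX.mem, Matrix.one_mul]
  simp [Matrix.trace, hD, Matrix.diagonal_mul]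

theorem exists_hasFDerivAt_trace_matPos_pow (k : ℕ) {A : F → Matrix (Fin d) (Fin d) ℝ}
    {A' : Fin d → Fin d → F →L[ℝ] ℝ} {x : F} (hsymm : ∀ z, (A z).IsSymm)
    (hA : ∀ a b, HasFDerivAt (fun z => A z a b) (A' a b) x) :
    ∃ L : F →L[ℝ] ℝ,
      (∀ h, L h = (k + 2) * (matPos (A x) ^ (k + 1) * Matrix.of fun a b => A' a b h).trace) ∧
      HasFDerivAt (fun z => (matPos (A z) ^ (k + 2)).trace) L x := by
  obtain ⟨Q, l, hx⟩ := exists_isDiagonalization (hsymm x)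
  choose L hL hL' using fun i => exists_hasFDerivAt_matPos_pow k hsymm hA hx i i
  refine ⟨∑ i, L i, fun h => ?_, HasFDerivAt.fun_sum fun i _ => hL' i⟩
  have h1 := trace_daleckiiKrein (H := Matrix.of fun a b => A' a b h) (posPowDivDiff_self k)
    ((hx.matPos.pow (k + 1)).smul ((k : ℝ) + 2))
  rw [Matrix.smul_mul, Matrix.trace_smul, smul_eq_mul] at h1
  rw [← h1, _root_.sum_apply]
  exact Finset.sum_congr rfl fun i _ => hL i h

end SpectralDerivative

/-! ### Derivatives of the penalty function and of the Lagrange function -/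

section Derivatives

variable {n m d : ℕ} (p : NSDP n m d)

theorem matInner_eq_sum (V W : Matrix (Fin d) (Fin d) ℝ) :
    matInner V W = ∑ i, ∑ j, V i j * W i j := by
  rw [matInner, Matrix.trace, Finset.sum_comm]
  simp [Matrix.mul_apply]

theorem hasFDerivAt_G_apply (x : EuclideanSpace ℝ (Fin n)) (i j : Fin d) :
    HasFDerivAt (fun z => p.G z i j) (fderiv ℝ (fun z => p.G z i j) x) x :=
  ((p.contDiff_G i j).differentiable (by norm_num) x).hasFDerivAt

theorem hasFDerivAt_g (x : EuclideanSpace ℝ (Fin n)) : HasFDerivAt p.g (fderiv ℝ p.g x) x :=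
  (p.contDiff_g.differentiable (by norm_num) x).hasFDerivAt

theorem hasFDerivAt_f (x : EuclideanSpace ℝ (Fin n)) : HasFDerivAt p.f (fderiv ℝ p.f x) x :=
  (p.contDiff_f.differentiable (by norm_num) x).hasFDerivAt

theorem isSymm_neg_G (z : EuclideanSpace ℝ (Fin n)) : (-p.G z).IsSymm := (p.isSymm_G z).neg

theorem isSymm_DG (x h : EuclideanSpace ℝ (Fin n)) : (p.DG x h).IsSymm := by
  ext i j
  have : (fun z => p.G z j i) = fun z => p.G z i j := funext fun z => (p.isSymm_G z).apply i j
  simp [DG, this]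

theorem isSymm_matPos_pow (z : EuclideanSpace ℝ (Fin n)) (k : ℕ) :
    (matPos (-p.G z) ^ k).IsSymm := by
  obtain ⟨Q, l, h⟩ := exists_isDiagonalization (p.isSymm_neg_G z)
  exact (h.matPos.pow k).isSymm

theorem hasFDerivAt_neg_G_apply (x : EuclideanSpace ℝ (Fin n)) (i j : Fin d) :
    HasFDerivAt (fun z => (-p.G z) i j) (-fderiv ℝ (fun z => p.G z i j) x) x := by
  exact (p.hasFDerivAt_G_apply x i j).neg

theorem of_neg_fderiv_G (x h : EuclideanSpace ℝ (Fin n)) :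
    (Matrix.of fun a b => (-fderiv ℝ (fun z => p.G z a b) x) h) = -p.DG x h := by
  ext a b; simp [DG]

theorem exists_hasFDerivAt_infeasibility (x : EuclideanSpace ℝ (Fin n)) :
    ∃ L : EuclideanSpace ℝ (Fin n) →L[ℝ] ℝ,
      (∀ h, L h = inner ℝ (p.g x) (fderiv ℝ p.g x h) -
        matInner (matPos (-p.G x) ^ 3) (p.DG x h)) ∧
      HasFDerivAt p.infeasibility L x := by
  obtain ⟨L, hL, hL'⟩ := exists_hasFDerivAt_trace_matPos_pow 2 p.isSymm_neg_G
    (p.hasFDerivAt_neg_G_apply x)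
  refine ⟨_, fun h => ?_, ((p.hasFDerivAt_g x).norm_sq.const_mul (1 / 2)).add
    (hL'.const_mul (1 / 4))⟩
  have := hL h
  rw [of_neg_fderiv_G] at this
  simp only [_root_.add_apply, _root_.smul_apply, smul_eq_mul, this,
    matInner, (p.isSymm_matPos_pow x 3).eq, Matrix.mul_neg, Matrix.trace_neg]
  norm_num
  ring

theorem penalty_eq (γ : ℝ) (z : EuclideanSpace ℝ (Fin n)) :
    p.penalty γ z = p.f z + γ * p.infeasibility z := by
  rw [penalty, infeasibility]; ring

theorem differentiable_infeasibility : Differentiable ℝ p.infeasibility := fun x => by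
  obtain ⟨L, -, h⟩ := p.exists_hasFDerivAt_infeasibility x
  exact h.differentiableAt

theorem fderiv_infeasibility (x h : EuclideanSpace ℝ (Fin n)) :
    fderiv ℝ p.infeasibility x h = inner ℝ (p.g x) (fderiv ℝ p.g x h) -
      matInner (matPos (-p.G x) ^ 3) (p.DG x h) := by
  obtain ⟨L, hL, hL'⟩ := p.exists_hasFDerivAt_infeasibility x
  rw [hL'.fderiv, hL]

theorem hasFDerivAt_penalty (γ : ℝ) (x : EuclideanSpace ℝ (Fin n)) :
    HasFDerivAt (p.penalty γ) (fderiv ℝ p.f x + γ • fderiv ℝ p.infeasibility x) x := by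
  have : p.penalty γ = fun z => p.f z + γ * p.infeasibility z := funext (p.penalty_eq γ)
  rw [this]
  exact (p.hasFDerivAt_f x).add ((p.differentiable_infeasibility x).hasFDerivAt.const_mul γ)

theorem exists_hasFDerivAt_lagrangian (y : EuclideanSpace ℝ (Fin m)) (Z : Matrix (Fin d) (Fin d) ℝ)
    (x : EuclideanSpace ℝ (Fin n)) :
    ∃ L : EuclideanSpace ℝ (Fin n) →L[ℝ] ℝ,
      (∀ h, L h = fderiv ℝ p.f x h - inner ℝ y (fderiv ℝ p.g x h) - matInner Z (p.DG x h)) ∧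
      HasFDerivAt (fun z => p.lagrangian z y Z) L x := by
  have h1 : (fun z => p.lagrangian z y Z) = fun z =>
      p.f z - inner ℝ y (p.g z) - ∑ i, ∑ j, Z i j * p.G z i j := by
    funext z
    rw [lagrangian, matInner_eq_sum, real_inner_comm]
    simp only [mul_comm]
  rw [h1]
  refine ⟨_, fun h => ?_, ((p.hasFDerivAt_f x).sub
    ((innerSL ℝ y).hasFDerivAt.comp x (p.hasFDerivAt_g x))).sub
    (HasFDerivAt.fun_sum fun i _ => HasFDerivAt.fun_sum fun j _ =>
      (p.hasFDerivAt_G_apply x i j).const_mul (Z i j))⟩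
  simp [matInner_eq_sum, DG]

theorem fderiv_lagrangian (y : EuclideanSpace ℝ (Fin m)) (Z : Matrix (Fin d) (Fin d) ℝ)
    (x h : EuclideanSpace ℝ (Fin n)) :
    fderiv ℝ (fun z => p.lagrangian z y Z) x h =
      fderiv ℝ p.f x h - inner ℝ y (fderiv ℝ p.g x h) - matInner Z (p.DG x h) := by
  obtain ⟨L, hL, hL'⟩ := p.exists_hasFDerivAt_lagrangian y Z x
  rw [hL'.fderiv, hL]

theorem gradient_eq_of_fderiv_eq {φ ψ : EuclideanSpace ℝ (Fin n) → ℝ}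
    {x : EuclideanSpace ℝ (Fin n)} (h : ∀ v, fderiv ℝ φ x v = fderiv ℝ ψ x v) :
    gradient φ x = gradient ψ x := by
  rw [gradient, gradient, ContinuousLinearMap.ext h]

/-- This identity dictates the choice of the multipliers. -/
theorem gradient_lagrangian_eq (γ : ℝ) (x : EuclideanSpace ℝ (Fin n)) :
    gradient (fun z => p.lagrangian z (-(γ • p.g x)) (γ • matPos (-p.G x) ^ 3)) x =
      gradient (p.penalty γ) x := by
  refine gradient_eq_of_fderiv_eq fun v => ?_
  rw [fderiv_lagrangian, (p.hasFDerivAt_penalty γ x).fderiv, _root_.add_apply,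
    _root_.smul_apply, fderiv_infeasibility, inner_neg_left, inner_smul_left]
  simp only [matInner, Matrix.transpose_smul, Matrix.smul_mul, Matrix.trace_smul, smul_eq_mul,
    RCLike.conj_to_real]
  ring

theorem gradient_penalty (γ : ℝ) (x : EuclideanSpace ℝ (Fin n)) :
    gradient (p.penalty γ) x = gradient p.f x + γ • gradient p.infeasibility x := by
  rw [gradient, gradient, gradient, (p.hasFDerivAt_penalty γ x).fderiv, map_add, map_smulₛₗ]
  simp

/-! ### Hessians -/

/-- In finite dimension a functional is a combination of coordinate projections, with its values on
the basis as coefficients. -/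
theorem differentiableAt_of_apply {φ : EuclideanSpace ℝ (Fin n) → EuclideanSpace ℝ (Fin n) →L[ℝ] ℝ}
    {x : EuclideanSpace ℝ (Fin n)} (h : ∀ v, DifferentiableAt ℝ (fun z => φ z v) x) :
    DifferentiableAt ℝ φ x := by
  have h1 : φ = fun z => ∑ i, φ z (EuclideanSpace.single i 1) •
      (EuclideanSpace.proj i : EuclideanSpace ℝ (Fin n) →L[ℝ] ℝ) := by
    funext z
    refine ContinuousLinearMap.ext fun v => ?_
    conv_lhs => rw [← (EuclideanSpace.basisFun (Fin n) ℝ).sum_repr v]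
    simp [mul_comm]
  rw [h1]
  exact DifferentiableAt.fun_sum fun i _ => (h _).smul_const _

/-- Reduces Hessians to derivatives of the scalar functions z ↦ Dφ(z)h with h fixed. -/
theorem dotProduct_hessian_mulVec {φ : EuclideanSpace ℝ (Fin n) → ℝ}
    {x : EuclideanSpace ℝ (Fin n)} (hφ : ∀ v, DifferentiableAt ℝ (fun z => fderiv ℝ φ z v) x)
    (h : EuclideanSpace ℝ (Fin n)) :
    h.ofLp ⬝ᵥ (hessian φ x).mulVec h.ofLp = fderiv ℝ (fun z => fderiv ℝ φ z h) x h := by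
  have h1 : fderiv ℝ (fun z => fderiv ℝ φ z h) x h = fderiv ℝ (fderiv ℝ φ) x h h := by
    rw [fderiv_clm_apply (differentiableAt_of_apply hφ) (differentiableAt_const h)]
    simp
  have h2 : ∀ v : EuclideanSpace ℝ (Fin n), ∑ i, v i • EuclideanSpace.single i (1 : ℝ) = v := by
    intro v
    simpa using (EuclideanSpace.basisFun (Fin n) ℝ).sum_repr v
  rw [h1]
  conv_rhs => rw [← h2 h]
  simp only [map_sum, map_smul, _root_.sum_apply, _root_.smul_apply,
    smul_eq_mul, dotProduct, Matrix.mulVec, hessian, Matrix.of_apply, Finset.mul_sum]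
  rw [Finset.sum_comm]
  exact Finset.sum_congr rfl fun i _ => Finset.sum_congr rfl fun j _ => by ring

theorem differentiableAt_DG_apply (x h : EuclideanSpace ℝ (Fin n)) (i j : Fin d) :
    DifferentiableAt ℝ (fun z => p.DG z h i j) x := by
  have : DifferentiableAt ℝ (fderiv ℝ (fun z => p.G z i j)) x :=
    ((p.contDiff_G i j).fderiv_right (m := 1) (by norm_num)).differentiable (by norm_num) x
  exact this.clm_apply (differentiableAt_const h)

theorem differentiableAt_fderiv_g_apply (x h : EuclideanSpace ℝ (Fin n)) :
    DifferentiableAt ℝ (fun z => fderiv ℝ p.g z h) x := by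
  have : DifferentiableAt ℝ (fderiv ℝ p.g) x :=
    (p.contDiff_g.fderiv_right (m := 1) (by norm_num)).differentiable (by norm_num) x
  exact this.clm_apply (differentiableAt_const h)

theorem differentiableAt_fderiv_f_apply (x h : EuclideanSpace ℝ (Fin n)) :
    DifferentiableAt ℝ (fun z => fderiv ℝ p.f z h) x := by
  have : DifferentiableAt ℝ (fderiv ℝ p.f) x :=
    (p.contDiff_f.fderiv_right (m := 1) (by norm_num)).differentiable (by norm_num) x
  exact this.clm_apply (differentiableAt_const h)

theorem differentiableAt_fderiv_lagrangian_apply (y : EuclideanSpace ℝ (Fin m))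
    (Z : Matrix (Fin d) (Fin d) ℝ) (x h : EuclideanSpace ℝ (Fin n)) :
    DifferentiableAt ℝ (fun z => fderiv ℝ (fun w => p.lagrangian w y Z) z h) x := by
  simp only [fderiv_lagrangian, matInner_eq_sum]
  refine ((p.differentiableAt_fderiv_f_apply x h).sub
    ((differentiableAt_const y).inner ℝ (p.differentiableAt_fderiv_g_apply x h))).sub
    (DifferentiableAt.fun_sum fun i _ => DifferentiableAt.fun_sum fun j _ =>
      (p.differentiableAt_DG_apply x h i j).const_mul (Z i j))

/-- With the multipliers frozen at x, the difference of the two derivatives has coefficients g(z) -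
g(x) and [-G(z)]₊³ - [-G(x)]₊³, both zero at z = x. By the product rule the second derivatives of g
and G drop out, and only the derivatives of the coefficients survive. -/
theorem exists_hasFDerivAt_fderiv_penalty_sub (γ : ℝ) {x : EuclideanSpace ℝ (Fin n)}
    {Q : Matrix (Fin d) (Fin d) ℝ} {l : Fin d → ℝ} (hx : IsDiagonalization (-p.G x) Q l)
    (h : EuclideanSpace ℝ (Fin n)) :
    ∃ L : EuclideanSpace ℝ (Fin n) →L[ℝ] ℝ,
      L h = γ * ‖fderiv ℝ p.g x h‖ ^ 2 +
        γ * matInner (daleckiiKrein (posPowDivDiff 1) Q l (p.DG x h)) (p.DG x h) ∧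
      HasFDerivAt (fun z => fderiv ℝ (p.penalty γ) z h - fderiv ℝ (fun w => p.lagrangian w
        (-(γ • p.g x)) (γ • matPos (-p.G x) ^ 3)) z h) L x := by
  choose L hL hL' using fun i j => exists_hasFDerivAt_matPos_pow 1 p.isSymm_neg_G
    (p.hasFDerivAt_neg_G_apply x) hx i j
  have h1 : (fun z => fderiv ℝ (p.penalty γ) z h - fderiv ℝ (fun w => p.lagrangian w
        (-(γ • p.g x)) (γ • matPos (-p.G x) ^ 3)) z h) = fun z =>
      γ * inner ℝ (p.g z - p.g x) (fderiv ℝ p.g z h) -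
        γ * ∑ i, ∑ j, ((matPos (-p.G z) ^ 3) i j - (matPos (-p.G x) ^ 3) i j) *
          p.DG z h i j := by
    funext z
    rw [(p.hasFDerivAt_penalty γ z).fderiv, _root_.add_apply,
      _root_.smul_apply, fderiv_infeasibility, fderiv_lagrangian, smul_eq_mul,
      inner_sub_left, inner_neg_left, inner_smul_left, matInner_eq_sum, matInner_eq_sum]
    simp only [sub_mul, Finset.sum_sub_distrib, Matrix.smul_apply, smul_eq_mul, mul_assoc,
      ← Finset.mul_sum, RCLike.conj_to_real]
    ring
  rw [h1]
  refine ⟨_, ?_, ((((p.hasFDerivAt_g x).sub_const (p.g x)).inner ℝ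
    (p.differentiableAt_fderiv_g_apply x h).hasFDerivAt).const_mul γ).sub
    ((HasFDerivAt.fun_sum fun i _ => HasFDerivAt.fun_sum fun j _ =>
      ((hL' i j).sub_const ((matPos (-p.G x) ^ 3) i j)).mul
        (p.differentiableAt_DG_apply x h i j).hasFDerivAt).const_mul γ)⟩
  -- The inner derivative of -G supplies this sign, which cancels the minus in front of the matrix
  -- term.
  have h2 : ∀ i j, L i j h = -daleckiiKrein (posPowDivDiff 1) Q l (p.DG x h) i j := by
    intro i j
    rw [hL, of_neg_fderiv_G, ← neg_one_smul ℝ (p.DG x h), daleckiiKrein_smul]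
    simp
  simp [h2, matInner_eq_sum, fderivInnerCLM_apply, Finset.sum_neg_distrib, mul_comm]

theorem dotProduct_hessian_penalty (γ : ℝ) {x : EuclideanSpace ℝ (Fin n)}
    {Q : Matrix (Fin d) (Fin d) ℝ} {l : Fin d → ℝ} (hx : IsDiagonalization (-p.G x) Q l)
    (h : EuclideanSpace ℝ (Fin n)) :
    h.ofLp ⬝ᵥ (hessian (p.penalty γ) x).mulVec h.ofLp =
      h.ofLp ⬝ᵥ (hessian (fun w => p.lagrangian w
        (-(γ • p.g x)) (γ • matPos (-p.G x) ^ 3)) x).mulVec h.ofLp +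
      γ * ‖fderiv ℝ p.g x h‖ ^ 2 +
        γ * matInner (daleckiiKrein (posPowDivDiff 1) Q l (p.DG x h)) (p.DG x h) := by
  have key : ∀ v, ∃ L : EuclideanSpace ℝ (Fin n) →L[ℝ] ℝ,
      L v = fderiv ℝ (fun z => fderiv ℝ (fun w => p.lagrangian w
        (-(γ • p.g x)) (γ • matPos (-p.G x) ^ 3)) z v) x v + γ * ‖fderiv ℝ p.g x v‖ ^ 2 +
        γ * matInner (daleckiiKrein (posPowDivDiff 1) Q l (p.DG x v)) (p.DG x v) ∧
      HasFDerivAt (fun z => fderiv ℝ (p.penalty γ) z v) L x := by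
    intro v
    obtain ⟨L, hL, hL'⟩ := p.exists_hasFDerivAt_fderiv_penalty_sub γ hx v
    have := hL'.add (p.differentiableAt_fderiv_lagrangian_apply (-(γ • p.g x))
      (γ • matPos (-p.G x) ^ 3) x v).hasFDerivAt
    refine ⟨_, ?_, this.congr_of_eventuallyEq (Eventually.of_forall fun z => ?_)⟩
    · rw [_root_.add_apply, hL]; ring
    · simp
  rw [dotProduct_hessian_mulVec (fun v => (key v).choose_spec.2.differentiableAt),
    dotProduct_hessian_mulVec (p.differentiableAt_fderiv_lagrangian_apply _ _ x)]
  obtain ⟨L, hL, hL'⟩ := key h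
  rw [hL'.fderiv, hL]

end Derivatives

/-! ### Limits of orthogonal diagonalizations -/

section Limits

variable {d : ℕ}

theorem exists_subseq_tendsto_of_mem_orthogonalGroup {Q : ℕ → Matrix (Fin d) (Fin d) ℝ}
    (h : ∀ k, Q k ∈ Matrix.orthogonalGroup (Fin d) ℝ) :
    ∃ (ψ : ℕ → ℕ) (P : Matrix (Fin d) (Fin d) ℝ), StrictMono ψ ∧
      Tendsto (fun k => Q (ψ k)) atTop (𝓝 P) := by
  have hcompact : IsCompact (Set.univ.pi fun _ : Fin d => Set.univ.pi fun _ : Fin d =>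
      Set.Icc (-1 : ℝ) 1) :=
    isCompact_univ_pi fun _ => isCompact_univ_pi fun _ => isCompact_Icc
  obtain ⟨P, -, ψ, hψ, hP⟩ := hcompact.tendsto_subseq (x := fun k i j => Q k i j)
    fun k i _ j _ => abs_le.1 (abs_entry_le_one (h k) i j)
  exact ⟨ψ, Matrix.of P, hψ, hP⟩

/-- Compactness is needed only for the orthogonal factors; the eigenvalues then converge as the
diagonal of QᵀXQ. -/
theorem exists_subseq_isDiagonalization {X Q : ℕ → Matrix (Fin d) (Fin d) ℝ} {l : ℕ → Fin d → ℝ}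
    {A : Matrix (Fin d) (Fin d) ℝ} (hX : Tendsto X atTop (𝓝 A))
    (h : ∀ k, IsDiagonalization (X k) (Q k) (l k)) :
    ∃ (ψ : ℕ → ℕ) (P : Matrix (Fin d) (Fin d) ℝ) (μ : Fin d → ℝ), StrictMono ψ ∧
      Tendsto (Q ∘ ψ) atTop (𝓝 P) ∧ Tendsto (l ∘ ψ) atTop (𝓝 μ) ∧ IsDiagonalization A P μ := by
  obtain ⟨ψ, P, hψ, hPQ⟩ := exists_subseq_tendsto_of_mem_orthogonalGroup fun k => (h k).mem
  have hXψ : Tendsto (fun k => X (ψ k)) atTop (𝓝 A) := hX.comp hψ.tendsto_atTop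
  have hPmem : P ∈ Matrix.orthogonalGroup (Fin d) ℝ := by
    rw [Matrix.mem_orthogonalGroup_iff]
    have hc : Continuous fun M : Matrix (Fin d) (Fin d) ℝ => M * M.transpose := by fun_prop
    refine tendsto_nhds_unique ((hc.tendsto P).comp hPQ) ?_
    refine tendsto_const_nhds.congr fun k => ?_
    exact (mul_transpose_self_of_mem (h (ψ k)).mem).symm
  have hPT : Tendsto (fun k => (Q (ψ k)).transpose) atTop (𝓝 P.transpose) :=
    (continuous_id.matrix_transpose.tendsto P).comp hPQ
  have hconj : Tendsto (fun k => (Q (ψ k)).transpose * X (ψ k) * Q (ψ k)) atTop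
      (𝓝 (P.transpose * A * P)) := (hPT.mul hXψ).mul hPQ
  have hl : Tendsto (l ∘ ψ) atTop (𝓝 fun i => (P.transpose * A * P) i i) := by
    rw [tendsto_pi_nhds]
    intro i
    have := (tendsto_pi_nhds.1 ((tendsto_pi_nhds.1 hconj) i)) i
    refine this.congr fun k => ?_
    rw [(h (ψ k)).conj_eq, Matrix.diagonal_apply_eq]; rfl
  refine ⟨ψ, P, _, hψ, hPQ, hl, hPmem, ?_⟩
  have hdiag : Tendsto (fun k => Matrix.diagonal (l (ψ k))) atTop
      (𝓝 (Matrix.diagonal fun i => (P.transpose * A * P) i i)) :=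
    (continuous_id.matrix_diagonal.tendsto _).comp hl
  refine tendsto_nhds_unique hXψ (((hPQ.mul hdiag).mul hPT).congr fun k => ?_)
  exact (h (ψ k)).eq.symm

theorem IsDiagonalization.finrank_ker {A P : Matrix (Fin d) (Fin d) ℝ} {μ : Fin d → ℝ}
    (h : IsDiagonalization A P μ) :
    Fintype.card {i // μ i ≠ 0} + Module.finrank ℝ (LinearMap.ker (Matrix.toLin' A)) = d := by
  have h1 : IsUnit P.det := by
    rw [← Matrix.isUnit_iff_isUnit_det]
    exact IsUnit.of_mul_eq_one _ (mul_transpose_self_of_mem h.mem)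
  have h2 : A.rank = Fintype.card {i // μ i ≠ 0} := by
    rw [h.eq, Matrix.rank_mul_eq_left_of_isUnit_det _ _ (by rwa [Matrix.det_transpose]),
      Matrix.rank_mul_eq_right_of_isUnit_det _ _ h1, Matrix.rank_diagonal]
  have h3 := LinearMap.finrank_range_add_finrank_ker (Matrix.toLin' A)
  rw [Module.finrank_fin_fun] at h3
  rw [← h2]
  exact h3

/-- By contradiction and compactness: a nonpositive eigenvalue among the first d - r, at points
tending to x₀, would leave at least r + 1 zero eigenvalues in the limit, more than the dimension r
of the kernel. -/
theorem eventually_forall_pos_of_posSemidef {F : Type*} [TopologicalSpace F]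
    [FirstCountableTopology F]
    {G : F → Matrix (Fin d) (Fin d) ℝ} {x₀ : F} (hG : ContinuousAt G x₀)
    (hpos : (G x₀).PosSemidef) :
    ∀ᶠ z in 𝓝 x₀, ∀ Q μ, IsDiagonalization (G z) Q μ → Antitone μ → ∀ j : Fin d,
      (j : ℕ) < d - Module.finrank ℝ (LinearMap.ker (Matrix.toLin' (G x₀))) → 0 < μ j := by
  set r := Module.finrank ℝ (LinearMap.ker (Matrix.toLin' (G x₀)))
  by_contra hcon
  obtain ⟨z, hz, hz'⟩ := exists_seq_forall_of_frequently (not_eventually.1 hcon)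
  push Not at hz'
  choose Q μ hQ hμ j hj hj' using hz'
  have hr : r < d := by have := hj 0; omega
  -- The last of the first d - r indices: by the descending order, a violation at any of them is
  -- also one here, so a single index serves the whole sequence.
  let j₀ : Fin d := ⟨d - r - 1, by omega⟩
  have hj₀ : ∀ k, μ k j₀ ≤ 0 := fun k =>
    (hμ k (by have := hj k; rw [Fin.le_def]; change (j k : ℕ) ≤ d - r - 1; omega)).trans (hj' k)
  obtain ⟨ψ, P, ν, -, -, hν, hP⟩ := exists_subseq_isDiagonalization (hG.tendsto.comp hz) hQ
  have hν' := tendsto_pi_nhds.1 hν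
  have hle : ∀ i, j₀ ≤ i → ν i = 0 := fun i hi =>
    le_antisymm (le_of_tendsto (hν' i) (Eventually.of_forall fun k =>
      (hμ (ψ k) hi).trans (hj₀ (ψ k)))) (hP.nonneg hpos i)
  have hcard := hP.finrank_ker
  have hsub : Fintype.card {i // ν i ≠ 0} ≤ d - r - 1 := by
    have : ∀ i : {i // ν i ≠ 0}, (i.1 : ℕ) < d - r - 1 := fun i => by
      by_contra hlt
      exact i.2 (hle i.1 (by rw [Fin.le_def]; change d - r - 1 ≤ (i.1 : ℕ); omega))
    have := Fintype.card_le_of_injective (fun i : {i // ν i ≠ 0} => (⟨i.1, this i⟩ : Fin (d - r - 1)))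
      (fun a b hab => Subtype.ext (Fin.ext (by simpa using hab)))
    simpa using this
  change _ + r = d at hcard
  omega

end Limits

/-! ### The sigma-term dominates the curvature of the penalty term -/

section Curvature

variable {n m d : ℕ} (p : NSDP n m d)

theorem matInner_daleckiiKrein (D : ℝ → ℝ → ℝ) (Q : Matrix (Fin d) (Fin d) ℝ) (l : Fin d → ℝ)
    (H : Matrix (Fin d) (Fin d) ℝ) :
    matInner (daleckiiKrein D Q l H) H =
      ∑ i, ∑ j, D (l i) (l j) * (Q.transpose * H * Q) i j ^ 2 := by
  set N := Matrix.of fun i j => D (l i) (l j) * (Q.transpose * H * Q) i j with hN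
  have h1 : matInner (daleckiiKrein D Q l H) H = matInner N (Q.transpose * H * Q) := by
    rw [daleckiiKrein, ← hN, matInner, matInner, Matrix.transpose_mul, Matrix.transpose_mul,
      Matrix.transpose_transpose, Matrix.mul_assoc, Matrix.trace_mul_comm]
    simp only [Matrix.mul_assoc]
  rw [h1, matInner_eq_sum]
  refine Finset.sum_congr rfl fun i _ => Finset.sum_congr rfl fun j _ => ?_
  rw [hN, Matrix.of_apply]; ring

theorem IsDiagonalization.matInner_mul_mul {X Y Q H : Matrix (Fin d) (Fin d) ℝ} {c b : Fin d → ℝ}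
    (hX : IsDiagonalization X Q c) (hY : IsDiagonalization Y Q b) (hH : H.IsSymm) :
    matInner X (H * Y * H) = ∑ i, ∑ j, c i * b j * (Q.transpose * H * Q) i j ^ 2 := by
  set K := Q.transpose * H * Q with hK
  have hKs : ∀ i j, K j i = K i j := by
    have : K.IsSymm := by
      rw [hK, Matrix.IsSymm, Matrix.transpose_mul, Matrix.transpose_mul, Matrix.transpose_transpose,
        hH.eq, Matrix.mul_assoc]
    exact fun i j => this.apply i j
  have h1 : matInner X (H * Y * H) = (Matrix.diagonal c * (K * Matrix.diagonal b * K)).trace := by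
    calc matInner X (H * Y * H) =
          (Q * (Matrix.diagonal c * Q.transpose * H * Q * Matrix.diagonal b * Q.transpose * H)).trace := by
          rw [matInner, hX.isSymm.eq]
          conv_lhs => rw [hX.eq, hY.eq]
          simp only [Matrix.mul_assoc]
      _ = _ := by rw [Matrix.trace_mul_comm, hK]; simp only [Matrix.mul_assoc]
  rw [h1, Matrix.trace]
  refine Finset.sum_congr rfl fun i _ => ?_
  rw [Matrix.diag_apply, Matrix.diagonal_mul, Matrix.mul_apply, Finset.mul_sum]
  refine Finset.sum_congr rfl fun j _ => ?_
  rw [Matrix.mul_diagonal, hKs i j]; ring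

/-- If b ≥ 0, both sides vanish. If b < 0, the left side is (-b)³/(a - b), and a - b ≥ a. The term
with b⁻¹ has coefficient zero, so b = 0 is harmless. -/
theorem posPowDivDiff_neg_le {a b : ℝ} (ha : 0 < a) :
    posPowDivDiff 1 (-a) (-b) ≤ max (-a) 0 ^ 3 * b⁻¹ + max (-b) 0 ^ 3 * a⁻¹ := by
  rw [max_eq_right (by linarith : -a ≤ 0)]
  rcases le_or_gt 0 b with hb | hb
  · rw [posPowDivDiff_of_nonpos 1 (by linarith) (by linarith), max_eq_right (by linarith)]
    simp
  · have h := posPowDivDiff_mul_sub 1 (-a) (-b)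
    rw [max_eq_right (by linarith : -a ≤ 0), max_eq_left (by linarith : 0 ≤ -b)] at h
    rw [max_eq_left (by linarith : 0 ≤ -b)]
    have hab : 0 < a - b := by linarith
    have h1 : posPowDivDiff 1 (-a) (-b) = (-b) ^ 3 * (a - b)⁻¹ := by
      rw [eq_mul_inv_iff_mul_eq₀ hab.ne']
      linear_combination -h
    rw [h1]
    have h2 : (a - b)⁻¹ ≤ a⁻¹ := inv_anti₀ ha (by linarith)
    have h3 : 0 ≤ (-b) ^ 3 := pow_nonneg (by linarith) 3
    simpa using mul_le_mul_of_nonneg_left h2 h3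

theorem matInner_daleckiiKrein_le {X Q H : Matrix (Fin d) (Fin d) ℝ} {μ : Fin d → ℝ} {s : Set (Fin d)}
    (hX : IsDiagonalization X Q μ) (hH : H.IsSymm) (hpos : ∀ i ∉ s, 0 < μ i)
    (hzero : ∀ i ∈ s, ∀ j ∈ s, (Q.transpose * H * Q) i j = 0) :
    matInner (daleckiiKrein (posPowDivDiff 1) Q (fun i => -μ i) H) H ≤
      2 * matInner (matPos (-X) ^ 3) (H * pinv X * H) := by
  set K := Q.transpose * H * Q with hK
  have hKs : ∀ i j, K j i = K i j := by
    have : K.IsSymm := by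
      rw [hK, Matrix.IsSymm, Matrix.transpose_mul, Matrix.transpose_mul, Matrix.transpose_transpose,
        hH.eq, Matrix.mul_assoc]
    exact fun i j => this.apply i j
  rw [matInner_daleckiiKrein, (hX.neg.matPos.pow 3).matInner_mul_mul hX.pinv hH, two_mul]
  -- Swapping the indices in one of the two copies of the sigma sum symmetrizes its coefficients, as
  -- the scalar inequality requires.
  conv_rhs => arg 2; rw [Finset.sum_comm]
  rw [← Finset.sum_add_distrib]
  refine Finset.sum_le_sum fun i _ => ?_
  rw [← Finset.sum_add_distrib]
  refine Finset.sum_le_sum fun j _ => ?_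
  rw [← hK, hKs i j, ← add_mul]
  by_cases hi : i ∈ s
  · by_cases hj : j ∈ s
    · rw [hzero i hi j hj]; simp
    · refine mul_le_mul_of_nonneg_right ?_ (sq_nonneg _)
      rw [posPowDivDiff_comm, add_comm]
      exact posPowDivDiff_neg_le (hpos j hj)
  · exact mul_le_mul_of_nonneg_right (posPowDivDiff_neg_le (hpos i hi)) (sq_nonneg _)

theorem dotProduct_sigmaTerm_mulVec (x h : EuclideanSpace ℝ (Fin n)) (Z : Matrix (Fin d) (Fin d) ℝ) :
    h.ofLp ⬝ᵥ (p.sigmaTerm x Z).mulVec h.ofLp =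
      2 * matInner Z (p.DG x h * pinv (p.G x) * p.DG x h) := by
  have h1 : p.DG x h = ∑ i, h i • p.partialG i x := by
    ext a b
    have h2 : ∑ i, h i • EuclideanSpace.single i (1 : ℝ) = h := by
      simpa using (EuclideanSpace.basisFun (Fin n) ℝ).sum_repr h
    simp only [partialG, DG, Matrix.of_apply, Matrix.sum_apply, Matrix.smul_apply]
    conv_lhs => rw [← h2]
    simp only [map_sum, map_smul]
  rw [h1, matInner]
  simp only [Finset.sum_mul, Finset.mul_sum, Matrix.smul_mul, Matrix.mul_smul, Matrix.trace_sum,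
    Matrix.trace_smul, smul_eq_mul, dotProduct, Matrix.mulVec, sigmaTerm, Matrix.of_apply, matInner]
  rw [Finset.sum_comm]
  exact Finset.sum_congr rfl fun i _ => Finset.sum_congr rfl fun j _ => by ring

/-- Vanishing of the form on the columns of U depends only on their span, so it transfers to the
eigenvectors indexed by s. -/
theorem transpose_mul_mul_apply_eq_zero {r : ℕ} {U : Matrix (Fin d) (Fin r) ℝ}
    {Q H : Matrix (Fin d) (Fin d) ℝ} {s : Set (Fin d)}
    (hspan : Submodule.span ℝ (Set.range U.col) = Submodule.span ℝ (Q.col '' s))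
    (hU : U.transpose * H * U = 0) :
    ∀ i ∈ s, ∀ j ∈ s, (Q.transpose * H * Q) i j = 0 := by
  have h1 : ∀ i ∈ s, ∃ c : Fin r → ℝ, U.mulVec c = Q.col i := by
    intro i hi
    have : Q.col i ∈ Submodule.span ℝ (Set.range U.col) := by
      rw [hspan]; exact Submodule.subset_span ⟨i, hi, rfl⟩
    rw [← Matrix.range_mulVecLin] at this
    obtain ⟨c, hc⟩ := this
    exact ⟨c, hc⟩
  intro i hi j hj
  obtain ⟨a, ha⟩ := h1 i hi
  obtain ⟨b, hb⟩ := h1 j hj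
  have h2 : (Q.transpose * H * Q) i j = Q.col i ⬝ᵥ H.mulVec (Q.col j) := by
    rw [Matrix.mul_assoc, Matrix.mul_apply]
    simp [dotProduct, Matrix.mul_apply, Matrix.mulVec]
  have h3 : U.mulVec a ⬝ᵥ H.mulVec (U.mulVec b) = a ⬝ᵥ (U.transpose * H * U).mulVec b := by
    rw [Matrix.mul_assoc, ← Matrix.mulVec_mulVec, ← Matrix.mulVec_mulVec, Matrix.dotProduct_mulVec a,
      Matrix.vecMul_transpose]
  rw [h2, ← ha, ← hb, h3, hU]
  simp

theorem continuous_G : Continuous p.G :=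
  continuous_pi fun i => continuous_pi fun j => (p.contDiff_G i j).continuous

theorem neg_mul_norm_sq_le_dotProduct {γ δ : ℝ} (hγ : 0 ≤ γ) {xbar x : EuclideanSpace ℝ (Fin n)}
    (hgap : ∀ Q μ, IsDiagonalization (p.G x) Q μ → Antitone μ → ∀ j : Fin d,
      (j : ℕ) < d - Module.finrank ℝ (LinearMap.ker (Matrix.toLin' (p.G xbar))) → 0 < μ j)
    (hpsd : (hessian (p.penalty γ) x + δ • (1 : Matrix (Fin n) (Fin n) ℝ)).PosSemidef)
    {h : EuclideanSpace ℝ (Fin n)} (hh : h ∈ p.perturbedCriticalSubspace xbar x) :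
    -δ * ‖h‖ ^ 2 ≤ h.ofLp ⬝ᵥ ((hessian (fun z => p.lagrangian z (-(γ • p.g x))
      (γ • matPos (-p.G x) ^ 3)) x + p.sigmaTerm x (γ • matPos (-p.G x) ^ 3)).mulVec h.ofLp) := by
  obtain ⟨hg, U, ⟨-, Q, μ, hQ, hμ, hQμ, hspan⟩, hU⟩ := hh
  have hdiag : IsDiagonalization (p.G x) Q μ := ⟨hQ, hQμ⟩
  have hle := matInner_daleckiiKrein_le hdiag (p.isSymm_DG x h)
    (fun i hi => hgap Q μ hdiag hμ i (not_le.1 hi)) (transpose_mul_mul_apply_eq_zero hspan hU)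
  have hhess := p.dotProduct_hessian_penalty γ hdiag.neg h
  have hnn := hpsd.dotProduct_mulVec_nonneg h.ofLp
  rw [Matrix.add_mulVec, dotProduct_add, Matrix.smul_mulVec, Matrix.one_mulVec, dotProduct_smul,
    star_trivial, hhess, hg] at hnn
  have hnorm : h.ofLp ⬝ᵥ h.ofLp = ‖h‖ ^ 2 := by
    rw [EuclideanSpace.norm_sq_eq]
    simp [dotProduct, sq]
  rw [hnorm] at hnn
  rw [Matrix.add_mulVec, dotProduct_add, dotProduct_sigmaTerm_mulVec]
  have hZ : matInner (γ • matPos (-p.G x) ^ 3) (p.DG x h * pinv (p.G x) * p.DG x h) =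
      γ * matInner (matPos (-p.G x) ^ 3) (p.DG x h * pinv (p.G x) * p.DG x h) := by
    simp [matInner]
  rw [hZ]
  have := mul_le_mul_of_nonneg_left hle hγ
  simp only [norm_zero, smul_eq_mul] at hnn
  linarith

end Curvature

section Algorithm

variable {n m d : ℕ} (p : NSDP n m d)

/-! ### The infeasibility measure -/

theorem trace_matPos_pow_four_nonneg (x : EuclideanSpace ℝ (Fin n)) :
    0 ≤ (matPos (-p.G x) ^ 4).trace := by
  obtain ⟨Q, l, h⟩ := exists_isDiagonalization (p.isSymm_neg_G x)
  rw [(h.matPos.pow 4).trace]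
  positivity

theorem infeasibility_nonneg (x : EuclideanSpace ℝ (Fin n)) : 0 ≤ p.infeasibility x := by
  have := p.trace_matPos_pow_four_nonneg x
  rw [infeasibility]
  positivity

theorem Feasible.infeasibility_eq_zero {p : NSDP n m d} {x : EuclideanSpace ℝ (Fin n)}
    (h : p.Feasible x) : p.infeasibility x = 0 := by
  obtain ⟨Q, μ, hG⟩ := exists_isDiagonalization (p.isSymm_G x)
  have h1 : ∀ i, max (-μ i) 0 ^ 4 = 0 := fun i => by
    rw [max_eq_right (by linarith [hG.nonneg h.2 i])]; norm_num
  rw [infeasibility, h.1, (hG.neg.matPos.pow 4).trace]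
  simp [h1]

theorem feasible_of_infeasibility_eq_zero {x : EuclideanSpace ℝ (Fin n)}
    (h : p.infeasibility x = 0) : p.Feasible x := by
  obtain ⟨Q, μ, hG⟩ := exists_isDiagonalization (p.isSymm_G x)
  have h1 := p.trace_matPos_pow_four_nonneg x
  have h2 := sq_nonneg ‖p.g x‖
  rw [infeasibility] at h
  have h3 : ‖p.g x‖ ^ 2 = 0 := by linarith
  have h4 : (matPos (-p.G x) ^ 4).trace = 0 := by linarith
  refine ⟨by simpa using h3, hG.posSemidef fun i => ?_⟩
  rw [(hG.neg.matPos.pow 4).trace, Finset.sum_eq_zero_iff_of_nonneg (fun i _ => by positivity)] at h4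
  have h5 := pow_eq_zero_iff (n := 4) (by norm_num) |>.1 (h4 i (Finset.mem_univ i))
  have h6 := le_max_left (-μ i) 0
  linarith

/-- The sum of fourth powers of the eigenvalues is at most the square of the sum of their squares.
-/
theorem infeasibility_le (x : EuclideanSpace ℝ (Fin n)) :
    p.infeasibility x ≤ 1 / 2 * p.violation x ^ 2 + 1 / 4 * p.violation x ^ 4 := by
  obtain ⟨Q, l, h⟩ := exists_isDiagonalization (p.isSymm_neg_G x)
  have h1 : frobNorm (matPos (-p.G x)) ^ 2 = ∑ i, max (l i) 0 ^ 2 := by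
    rw [frobNorm, matInner, h.matPos.isSymm.eq, ← sq, (h.matPos.pow 2).trace,
      Real.sq_sqrt (by positivity)]
  have h2 : (matPos (-p.G x) ^ 4).trace ≤ frobNorm (matPos (-p.G x)) ^ 4 := by
    have := Finset.sum_sq_le_sq_sum_of_nonneg (s := Finset.univ) (f := fun i => max (l i) 0 ^ 2)
      (fun i _ => by positivity)
    calc (matPos (-p.G x) ^ 4).trace = ∑ i, (max (l i) 0 ^ 2) ^ 2 := by
          rw [(h.matPos.pow 4).trace]
          exact Finset.sum_congr rfl fun i _ => by ring
      _ ≤ (∑ i, max (l i) 0 ^ 2) ^ 2 := this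
      _ = _ := by rw [← h1]; ring
  have h3 : ‖p.g x‖ ≤ p.violation x := le_max_left _ _
  have h4 : frobNorm (matPos (-p.G x)) ≤ p.violation x := le_max_right _ _
  have h5 : 0 ≤ frobNorm (matPos (-p.G x)) := Real.sqrt_nonneg _
  have h6 := pow_le_pow_left₀ (norm_nonneg _) h3 2
  have h7 := pow_le_pow_left₀ h5 h4 4
  rw [infeasibility]
  linarith

theorem violation_nonneg (x : EuclideanSpace ℝ (Fin n)) : 0 ≤ p.violation x :=
  (norm_nonneg _).trans (le_max_left _ _)

/-! ### The penalty method drives the infeasibility to zero -/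

namespace IsPenaltyRun

variable {p} {η θ : ℝ} {δ γ : ℕ → ℝ} {x xhat : ℕ → EuclideanSpace ℝ (Fin n)}

theorem gamma_pos (h : p.IsPenaltyRun η θ δ γ x xhat) (k : ℕ) : 0 < γ k := by
  induction k with
  | zero => exact h.gamma_zero
  | succ k ih =>
    rw [h.gamma_succ]
    split_ifs
    · exact ih
    · have := h.one_lt_theta; positivity

theorem gamma_le_succ (h : p.IsPenaltyRun η θ δ γ x xhat) (k : ℕ) : γ k ≤ γ (k + 1) := by
  rw [h.gamma_succ]
  split_ifs
  · exact le_rfl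
  · exact le_mul_of_one_le_left (h.gamma_pos k).le h.one_lt_theta.le

theorem gamma_succ_le (h : p.IsPenaltyRun η θ δ γ x xhat) (k : ℕ) : γ (k + 1) ≤ θ * γ k := by
  rw [h.gamma_succ]
  split_ifs
  · exact le_mul_of_one_le_left (h.gamma_pos k).le h.one_lt_theta.le
  · exact le_rfl

theorem penalty_le (h : p.IsPenaltyRun η θ δ γ x xhat) {c : ℝ} (hc : ∀ k, c ≤ p.f (x k)) (k : ℕ) :
    p.penalty (γ k) (x (k + 1)) ≤ p.f (x 0) + (θ - 1) * (p.f (x 0) - c) := by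
  refine (h.descent k).trans ?_
  have hθ := h.one_lt_theta
  have h0 : ∀ a, p.penalty a (x 0) ≤ p.f (x 0) + (θ - 1) * (p.f (x 0) - c) := fun a => by
    rw [penalty_eq, h.feasible_zero.infeasibility_eq_zero, mul_zero, add_zero]
    have : 0 ≤ (θ - 1) * (p.f (x 0) - c) :=
      mul_nonneg (by linarith) (sub_nonneg.2 (hc 0))
    linarith
  cases k with
  | zero => rw [h.xhat_zero]; exact h0 _
  | succ k =>
    rw [h.xhat_succ]
    split_ifs with hif
    -- The acceptance test used the previous parameter. Raising it by a factor of at most θ adds at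
    -- most θ - 1 times the old penalty term, which the test bounds by f(x₀) - c.
    · rw [penalty_eq] at hif ⊢
      have h1 := p.infeasibility_nonneg (x (k + 1))
      have h2 := mul_le_mul_of_nonneg_right (h.gamma_succ_le k) h1
      have h3 : γ k * p.infeasibility (x (k + 1)) ≤ p.f (x 0) - c := by linarith [hc (k + 1)]
      have h4 := mul_le_mul_of_nonneg_left h3 (by linarith : 0 ≤ θ - 1)
      linarith
    · exact h0 _

/-- Each of the infinitely many increases is at least (θ - 1)γ₀, so the monotone sequence cannot
converge. -/
theorem tendsto_gamma (h : p.IsPenaltyRun η θ δ γ x xhat) (hf : ∃ᶠ k in atTop,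
    ¬ (k = 0 ∨ p.violation (x (k + 1)) ≤ η * p.violation (x k))) : Tendsto γ atTop atTop := by
  have hmono : Monotone γ := monotone_nat_of_le_succ h.gamma_le_succ
  rcases tendsto_atTop_of_monotone hmono with h1 | ⟨a, ha⟩
  · exact h1
  · exfalso
    have h2 : Tendsto (fun k => γ (k + 1) - γ k) atTop (𝓝 0) := by
      simpa using (ha.comp (tendsto_add_atTop_nat 1)).sub ha
    have h3 : 0 < (θ - 1) * γ 0 := mul_pos (by linarith [h.one_lt_theta]) h.gamma_zero
    obtain ⟨k, hk, hk'⟩ := (hf.and_eventually (h2.eventually (gt_mem_nhds h3))).exists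
    rw [h.gamma_succ, if_neg hk] at hk'
    have h4 := mul_le_mul_of_nonneg_left (hmono (Nat.zero_le k))
      (by linarith [h.one_lt_theta] : 0 ≤ θ - 1)
    linarith

theorem tendsto_infeasibility (h : p.IsPenaltyRun η θ δ γ x xhat)
    (hbdd : BddBelow (Set.range fun k => p.f (x k))) :
    Tendsto (fun k => p.infeasibility (x k)) atTop (𝓝 0) := by
  by_cases hf : ∃ᶠ k in atTop, ¬ (k = 0 ∨ p.violation (x (k + 1)) ≤ η * p.violation (x k))
  · obtain ⟨c, hc⟩ := hbdd
    have hc' : ∀ k, c ≤ p.f (x k) := fun k => hc ⟨k, rfl⟩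
    rw [← tendsto_add_atTop_iff_nat 1]
    refine squeeze_zero (fun k => p.infeasibility_nonneg _) (fun k => ?_)
      ((h.tendsto_gamma hf).const_div_atTop (p.f (x 0) + (θ - 1) * (p.f (x 0) - c) - c))
    -- Bounded penalty values and f ≥ c bound γ_k 𝒫(x_{k+1}) by a constant.
    rw [le_div_iff₀ (h.gamma_pos k), mul_comm]
    have := h.penalty_le hc' k
    rw [penalty_eq] at this
    linarith [hc' (k + 1)]
  · rw [not_frequently] at hf
    -- Taking K > 0 excludes k = 0, where an unchanged parameter says nothing about the violation.
    obtain ⟨K, hK⟩ := eventually_atTop.1 (hf.and (eventually_gt_atTop 0))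
    have hstep : ∀ k, p.violation (x (K + k)) ≤ η ^ k * p.violation (x K) := by
      intro k
      induction k with
      | zero => simp
      | succ k ih =>
        have h1 := hK (K + k) (Nat.le_add_right _ _)
        have h2 := (not_not.1 h1.1).resolve_left h1.2.ne'
        calc p.violation (x (K + (k + 1))) ≤ η * p.violation (x (K + k)) := h2
          _ ≤ η * (η ^ k * p.violation (x K)) := mul_le_mul_of_nonneg_left ih h.eta_mem.1.le
          _ = _ := by ring
    have h3 : Tendsto (fun k => p.violation (x (K + k))) atTop (𝓝 0) :=
      squeeze_zero (fun k => p.violation_nonneg _) hstep (by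
        simpa using (tendsto_pow_atTop_nhds_zero_of_lt_one h.eta_mem.1.le h.eta_mem.2).mul_const
          (p.violation (x K)))
    have h4 : Tendsto (fun k => p.infeasibility (x (K + k))) atTop (𝓝 0) := by
      refine squeeze_zero (fun k => p.infeasibility_nonneg _) (fun k => p.infeasibility_le _) ?_
      have := ((h3.pow 2).const_mul (1 / 2)).add ((h3.pow 4).const_mul (1 / 4))
      norm_num at this ⊢
      exact this
    rw [← tendsto_add_atTop_iff_nat K]
    simpa only [add_comm] using h4

theorem feasible_of_tendsto (h : p.IsPenaltyRun η θ δ γ x xhat)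
    (hbdd : BddBelow (Set.range fun k => p.f (x k))) {xbar : EuclideanSpace ℝ (Fin n)}
    {φ : ℕ → ℕ} (hφ : StrictMono φ) (hlim : Tendsto (x ∘ φ) atTop (𝓝 xbar)) :
    p.Feasible xbar := by
  refine p.feasible_of_infeasibility_eq_zero (tendsto_nhds_unique
    ((p.differentiable_infeasibility.continuous.tendsto xbar).comp hlim) ?_)
  exact (h.tendsto_infeasibility hbdd).comp hφ.tendsto_atTop

/-! ### Sequential optimality of the accumulation points -/

section Multipliers

variable {y : ℕ → EuclideanSpace ℝ (Fin m)} {Z : ℕ → Matrix (Fin d) (Fin d) ℝ} {ε : ℕ → ℝ}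
  {xbar : EuclideanSpace ℝ (Fin n)} {φ : ℕ → ℕ}

theorem posSemidef_multiplier (h : p.IsPenaltyRun η θ δ γ x xhat)
    (hZ : ∀ k ≥ 1, Z k = γ (k - 1) • matPos (-p.G (x k)) ^ 3) {k : ℕ} (hk : 1 ≤ k) :
    (Z k).PosSemidef := by
  obtain ⟨Q, l, hd⟩ := exists_isDiagonalization (p.isSymm_neg_G (x k))
  rw [hZ k hk]
  refine ((hd.matPos.pow 3).smul _).posSemidef fun i => ?_
  have := h.gamma_pos (k - 1)
  positivity

theorem tendsto_gradient_penalty (h : p.IsPenaltyRun η θ δ γ x xhat) (hφ : StrictMono φ)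
    (hφ1 : 1 ≤ φ 0) :
    Tendsto (fun k => gradient (p.penalty (γ (φ k - 1))) (x (φ k))) atTop (𝓝 0) := by
  have hsub : Tendsto (fun k => φ k - 1) atTop atTop :=
    (tendsto_sub_atTop_nat 1).comp hφ.tendsto_atTop
  refine squeeze_zero_norm (fun k => ?_) (h.delta_tendsto.comp hsub)
  have := h.gradient_le (φ k - 1)
  rwa [Nat.sub_add_cancel (hφ1.trans (hφ.monotone (Nat.zero_le k)))] at this

theorem tendsto_gradient_lagrangian (h : p.IsPenaltyRun η θ δ γ x xhat)
    (hy : ∀ k ≥ 1, y k = -(γ (k - 1) • p.g (x k)))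
    (hZ : ∀ k ≥ 1, Z k = γ (k - 1) • matPos (-p.G (x k)) ^ 3)
    (hφ : StrictMono φ) (hφ1 : 1 ≤ φ 0) :
    Tendsto (fun k => gradient (fun z => p.lagrangian z ((y ∘ φ) k) ((Z ∘ φ) k)) ((x ∘ φ) k))
      atTop (𝓝 0) := by
  refine (h.tendsto_gradient_penalty hφ hφ1).congr fun k => ?_
  have hk : 1 ≤ φ k := hφ1.trans (hφ.monotone (Nat.zero_le k))
  simp only [Function.comp_apply, hy _ hk, hZ _ hk]
  exact (p.gradient_lagrangian_eq _ _).symm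

theorem secondOrderSeq (h : p.IsPenaltyRun η θ δ γ x xhat)
    (hy : ∀ k ≥ 1, y k = -(γ (k - 1) • p.g (x k)))
    (hZ : ∀ k ≥ 1, Z k = γ (k - 1) • matPos (-p.G (x k)) ^ 3)
    (hε : ∀ k ≥ 1, ε k = δ (k - 1)) (hfeas : p.Feasible xbar)
    (hφ : StrictMono φ) (hφ1 : 1 ≤ φ 0) (hlim : Tendsto (x ∘ φ) atTop (𝓝 xbar)) :
    p.SecondOrderSeq xbar (x ∘ φ) (y ∘ φ) (Z ∘ φ) (ε ∘ φ) := by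
  have hk : ∀ k, 1 ≤ φ k := fun k => hφ1.trans (hφ.monotone (Nat.zero_le k))
  have hsub : Tendsto (fun k => φ k - 1) atTop atTop :=
    (tendsto_sub_atTop_nat 1).comp hφ.tendsto_atTop
  refine ⟨fun k => ?_, ?_, ?_⟩
  · rw [Function.comp_apply, hε _ (hk k)]
    exact (h.delta_mem _).1
  · refine (h.delta_tendsto.comp hsub).congr fun k => ?_
    simp only [Function.comp_apply, hε _ (hk k)]
  · obtain ⟨N, hN⟩ := eventually_atTop.1 (hlim.eventually
      (eventually_forall_pos_of_posSemidef p.continuous_G.continuousAt hfeas.2))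
    refine ⟨N, fun k hkN v hv => ?_⟩
    have hpsd := h.hessian_posSemidef (φ k - 1)
    rw [Nat.sub_add_cancel (hk k)] at hpsd
    simp only [Function.comp_apply, hy _ (hk k), hZ _ (hk k), hε _ (hk k)]
    exact p.neg_mul_norm_sq_le_dotProduct (h.gamma_pos _).le (hN k hkN) hpsd hv

theorem exists_isAKKT2Seq (h : p.IsPenaltyRun η θ δ γ x xhat)
    (hy : ∀ k ≥ 1, y k = -(γ (k - 1) • p.g (x k)))
    (hZ : ∀ k ≥ 1, Z k = γ (k - 1) • matPos (-p.G (x k)) ^ 3)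
    (hε : ∀ k ≥ 1, ε k = δ (k - 1)) (hfeas : p.Feasible xbar)
    (hφ : StrictMono φ) (hφ1 : 1 ≤ φ 0) (hlim : Tendsto (x ∘ φ) atTop (𝓝 xbar)) :
    ∃ ψ : ℕ → ℕ, StrictMono ψ ∧
      p.IsAKKT2Seq xbar (x ∘ φ ∘ ψ) (y ∘ φ ∘ ψ) (Z ∘ φ ∘ ψ) (ε ∘ φ ∘ ψ) := by
  choose Q l hQ using fun k => exists_isDiagonalization (p.isSymm_G (x (φ k)))
  have hG : Tendsto (fun k => p.G (x (φ k))) atTop (𝓝 (p.G xbar)) :=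
    (p.continuous_G.tendsto xbar).comp hlim
  obtain ⟨ψ, P, μ, hψ, hP, hl, hPμ⟩ := exists_subseq_isDiagonalization hG hQ
  have hφψ : StrictMono (φ ∘ ψ) := hφ.comp hψ
  have h1 : 1 ≤ (φ ∘ ψ) 0 := hφ1.trans (hφ.monotone (Nat.zero_le _))
  have hk : ∀ k, 1 ≤ (φ ∘ ψ) k := fun k => h1.trans (hφψ.monotone (Nat.zero_le k))
  have hlim' : Tendsto (x ∘ φ ∘ ψ) atTop (𝓝 xbar) := hlim.comp hψ.tendsto_atTop
  refine ⟨ψ, hψ, ⟨fun k => h.posSemidef_multiplier hZ (hk k), hlim',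
    h.tendsto_gradient_lagrangian hy hZ hφψ h1, P, Q ∘ ψ, μ,
    fun k i => γ ((φ ∘ ψ) k - 1) * max (-l (ψ k) i) 0 ^ 3, hPμ.mem, fun k => (hQ _).mem, hP, hPμ.eq,
    fun k => ?_, fun j hj => ?_⟩, h.secondOrderSeq hy hZ hε hfeas hφψ h1 hlim'⟩
  · have := (((hQ (ψ k)).neg.matPos.pow 3).smul (γ ((φ ∘ ψ) k - 1))).eq
    rw [Function.comp_apply, hZ _ (hk k)]
    exact this
  · obtain ⟨K, hK⟩ := eventually_atTop.1 (((tendsto_pi_nhds.1 hl) j).eventually (lt_mem_nhds hj))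
    refine ⟨K, fun k hkK => ?_⟩
    have : 0 < l (ψ k) j := hK k hkK
    simp [max_eq_right (by linarith : -l (ψ k) j ≤ 0)]

theorem tendsto_gamma_mul_infeasibility (h : p.IsPenaltyRun η θ δ γ x xhat)
    (hPL : p.GeneralizedPL xbar) (hfeas : p.Feasible xbar)
    (hφ : StrictMono φ) (hφ1 : 1 ≤ φ 0) (hlim : Tendsto (x ∘ φ) atTop (𝓝 xbar)) :
    Tendsto (fun k => γ (φ k - 1) * p.infeasibility (x (φ k))) atTop (𝓝 0) := by
  obtain ⟨ν, hν, Ψ, hΨ, hineq⟩ := hPL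
  rw [hfeas.infeasibility_eq_zero] at hineq
  have hgf : Continuous (gradient p.f) := by
    have : Continuous (fderiv ℝ p.f) := p.contDiff_f.continuous_fderiv (by norm_num)
    exact (InnerProductSpace.toDual ℝ _).symm.continuous.comp this
  have hgrad : Tendsto (fun k => γ (φ k - 1) • gradient p.infeasibility (x (φ k))) atTop
      (𝓝 (0 - gradient p.f xbar)) := by
    refine ((h.tendsto_gradient_penalty hφ hφ1).sub ((hgf.tendsto xbar).comp hlim)).congr fun k => ?_
    rw [gradient_penalty]
    simp
  classical
  set Ψ' := Function.update Ψ xbar 0 with hΨ'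
  have hΨ'lim : Tendsto Ψ' (𝓝 xbar) (𝓝 0) := by
    have := continuousAt_update_same (f := Ψ) (x := xbar) (y := (0 : ℝ)) |>.2 hΨ
    simpa [ContinuousAt, hΨ'] using this
  have hprod := (hΨ'lim.comp hlim).mul hgrad.norm
  rw [zero_mul] at hprod
  refine tendsto_of_tendsto_of_tendsto_of_le_of_le' tendsto_const_nhds hprod
    (Eventually.of_forall fun k => mul_nonneg (h.gamma_pos _).le (p.infeasibility_nonneg _)) ?_
  filter_upwards [hlim.eventually (Metric.closedBall_mem_nhds xbar hν)] with k hk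
  have hγ := h.gamma_pos (φ k - 1)
  by_cases hx : x (φ k) = xbar
  · simp [hx, hfeas.infeasibility_eq_zero, hΨ']
  · have h1 := hineq _ hk
    rw [sub_zero, abs_of_nonneg (p.infeasibility_nonneg _)] at h1
    have h2 : Ψ' (x (φ k)) = Ψ (x (φ k)) := Function.update_of_ne hx _ _
    simp only [Function.comp_apply] at h1 ⊢
    rw [h2, norm_smul, Real.norm_of_nonneg hγ.le]
    calc γ (φ k - 1) * p.infeasibility (x (φ k))
        ≤ γ (φ k - 1) * (Ψ (x (φ k)) * ‖gradient p.infeasibility (x (φ k))‖) :=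
          mul_le_mul_of_nonneg_left h1 hγ.le
      _ = _ := by ring

theorem isCAKKT2Seq (h : p.IsPenaltyRun η θ δ γ x xhat)
    (hy : ∀ k ≥ 1, y k = -(γ (k - 1) • p.g (x k)))
    (hZ : ∀ k ≥ 1, Z k = γ (k - 1) • matPos (-p.G (x k)) ^ 3)
    (hε : ∀ k ≥ 1, ε k = δ (k - 1)) (hPL : p.GeneralizedPL xbar) (hfeas : p.Feasible xbar)
    (hφ : StrictMono φ) (hφ1 : 1 ≤ φ 0) (hlim : Tendsto (x ∘ φ) atTop (𝓝 xbar)) :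
    p.IsCAKKT2Seq xbar (x ∘ φ) (y ∘ φ) (Z ∘ φ) (ε ∘ φ) := by
  have hk : ∀ k, 1 ≤ φ k := fun k => hφ1.trans (hφ.monotone (Nat.zero_le k))
  refine ⟨⟨fun k => h.posSemidef_multiplier hZ (hk k), hlim,
    h.tendsto_gradient_lagrangian hy hZ hφ hφ1, ?_⟩,
    h.secondOrderSeq hy hZ hε hfeas hφ hφ1 hlim⟩
  have hinf := (h.tendsto_gamma_mul_infeasibility hPL hfeas hφ hφ1 hlim).const_mul 4
  rw [mul_zero] at hinf
  refine tendsto_pi_nhds.2 fun i => tendsto_pi_nhds.2 fun j => ?_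
  refine squeeze_zero_norm (fun k => ?_) hinf
  obtain ⟨Q, μ, hd⟩ := exists_isDiagonalization (p.isSymm_G (x (φ k)))
  have hγ := h.gamma_pos (φ k - 1)
  have hz := (hd.neg.matPos.pow 3).smul (γ (φ k - 1))
  have hsym := ((hd.mul hz).add (hz.mul hd)).smul (1 / 2)
  have hle := hsym.abs_apply_le i j
  have htr := (hd.neg.matPos.pow 4).trace
  have hval : ∀ a, |1 / 2 * (μ a * (γ (φ k - 1) * max (-μ a) 0 ^ 3) +
      γ (φ k - 1) * max (-μ a) 0 ^ 3 * μ a)| = γ (φ k - 1) * max (-μ a) 0 ^ 4 := by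
    intro a
    rcases le_total (μ a) 0 with ha | ha
    · rw [max_eq_left (by linarith : 0 ≤ -μ a)]
      have : 1 / 2 * (μ a * (γ (φ k - 1) * (-μ a) ^ 3) + γ (φ k - 1) * (-μ a) ^ 3 * μ a) =
          -(γ (φ k - 1) * (-μ a) ^ 4) := by ring
      rw [this, abs_neg, abs_of_nonneg (mul_nonneg hγ.le (pow_nonneg (by linarith) 4))]
    · rw [max_eq_right (by linarith : -μ a ≤ 0)]; simp
  rw [Finset.sum_congr rfl fun a _ => hval a, ← Finset.mul_sum, ← htr] at hle
  have hg : 0 ≤ γ (φ k - 1) * ‖p.g (x (φ k))‖ ^ 2 := by positivity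
  simp only [Function.comp_apply, hZ _ (hk k), Real.norm_eq_abs]
  refine hle.trans ?_
  rw [infeasibility]
  linarith

end Multipliers

end IsPenaltyRun

end Algorithm

end NSDP


theorem mainTheorem2 {n m d : ℕ} (p : NSDP n m d) (η θ : ℝ) (δ γ : ℕ → ℝ)
    (x xhat : ℕ → EuclideanSpace ℝ (Fin n))
    (hrun : p.IsPenaltyRun η θ δ γ x xhat)
    (hbdd : BddBelow (Set.range fun k => p.f (x k)))
    (y : ℕ → EuclideanSpace ℝ (Fin m)) (Z : ℕ → Matrix (Fin d) (Fin d) ℝ) (ε : ℕ → ℝ)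
    (hy : ∀ k ≥ 1, y k = -(γ (k - 1) • p.g (x k)))
    (hZ : ∀ k ≥ 1, Z k = γ (k - 1) • NSDP.matPos (-p.G (x k)) ^ 3)
    (hε : ∀ k ≥ 1, ε k = δ (k - 1))
    (xbar : EuclideanSpace ℝ (Fin n)) (hacc : MapClusterPt xbar atTop x) :
    (p.IsAKKT2Point xbar ∧
      ∀ φ : ℕ → ℕ, StrictMono φ → 1 ≤ φ 0 → Tendsto (x ∘ φ) atTop (𝓝 xbar) →
        ∃ ψ : ℕ → ℕ, StrictMono ψ ∧
          p.IsAKKT2Seq xbar (x ∘ φ ∘ ψ) (y ∘ φ ∘ ψ) (Z ∘ φ ∘ ψ) (ε ∘ φ ∘ ψ)) ∧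
    (p.GeneralizedPL xbar →
      p.IsCAKKT2Point xbar ∧
      ∀ φ : ℕ → ℕ, StrictMono φ → 1 ≤ φ 0 → Tendsto (x ∘ φ) atTop (𝓝 xbar) →
        p.IsCAKKT2Seq xbar (x ∘ φ) (y ∘ φ) (Z ∘ φ) (ε ∘ φ)) := by
  have hpoint : ∃ φ : ℕ → ℕ, StrictMono φ ∧ 1 ≤ φ 0 ∧ Tendsto (x ∘ φ) atTop (𝓝 xbar) := by
    obtain ⟨φ, hφ, hlim⟩ := hacc.tendsto_subseq
    have hφ1 : StrictMono fun k => φ (k + 1) := fun a b hab => hφ (Nat.succ_lt_succ hab)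
    exact ⟨fun k => φ (k + 1), hφ1, (Nat.zero_le _).trans_lt (hφ Nat.zero_lt_one),
      hlim.comp (tendsto_add_atTop_nat 1)⟩
  obtain ⟨φ₀, hφ₀, hφ₀1, hlim₀⟩ := hpoint
  have hfeas : p.Feasible xbar := hrun.feasible_of_tendsto hbdd hφ₀ hlim₀
  refine ⟨⟨⟨hfeas, ?_⟩, fun φ hφ hφ1 hlim =>
    hrun.exists_isAKKT2Seq hy hZ hε hfeas hφ hφ1 hlim⟩, fun hPL => ⟨⟨hfeas, ?_⟩,
    fun φ hφ hφ1 hlim => hrun.isCAKKT2Seq hy hZ hε hPL hfeas hφ hφ1 hlim⟩⟩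
  · obtain ⟨ψ, -, hψ⟩ := hrun.exists_isAKKT2Seq hy hZ hε hfeas hφ₀ hφ₀1 hlim₀
    exact ⟨_, _, _, _, hψ⟩
  · exact ⟨_, _, _, _, hrun.isCAKKT2Seq hy hZ hε hPL hfeas hφ₀ hφ₀1 hlim₀⟩
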